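/- Let $k\ge 2$ be a composite integer that is not a power of $2$. Then there exist an integer $N$, a real $L>1$ and points $\nu_1,\dots,\nu_N\in\mathbb R^2$ such that, for the similitudes $\Psi_i(x)=x/L+\nu_i$ of the plane and the unique nonempty compact set $\mathcal K=\mathcal K^{\langle 0\rangle}\subset\mathbb R^2$ with $\mathcal K=\bigcup_{i=1}^N\Psi_i(\mathcal K)$: $\mathcal K$ is a simple nested fractal with exactly $k$ essential fixed points, the origin is one of them, and the unbounded fractal $\mathcal K^{\langle\infty\rangle}$ does not have the good labelling property (GLP). The notions are as follows. Essential fixed points. Let $F$ be the set of the fixed points of $\Psi_1,\dots,\Psi_N$. A point $x\in F$ is an essential fixed point if $\Psi_i(x)=\Psi_j(y)$ for some $y\in F$, $y\ne x$, and some $i\neq j$. The set of the essential fixed points is $V_0^{\langle 0\rangle}$, and $k=\#V_0^{\langle0\rangle}$. Simple nested fractal. $\mathcal K$ is a simple nested fractal if (1) $\#V_0^{\langle0\rangle}\ge 2$; (2) there is a nonempty open set $U\subset\mathbb R^2$ with $\Psi_i(U)\cap\Psi_j(U)=\emptyset$ for $i\ne j$ and $\bigcup_i\Psi_i(U)\subseteq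 U$; (3) $\Psi_i(\mathcal K)\cap\Psi_j(\mathcal K)=\Psi_i(V_0^{\langle0\rangle})\cap\Psi_j(V_0^{\langle0\rangle})$ for $i\ne j$; (4) for every $i$ and all distinct $x,y\in V_0^{\langle0\rangle}$ there is $j$ with $S_{x,y}(\Psi_i(V_0^{\langle0\rangle}))=\Psi_j(V_0^{\langle0\rangle})$, where $S_{x,y}$ is the reflection in the perpendicular bisector of the segment $[x,y]$; (5) the graph on the vertex set $\bigcup_i\Psi_i(V_0^{\langle0\rangle})$, in which two distinct points are joined if and only if they both lie in $\Psi_i(\mathcal K)$ for some $i$, is connected. Unbounded fractal and complexes. For $M\in\mathbb Z$ put $\mathcal K^{\langle M\rangle}=L^M\mathcal K$ and $V_M^{\langle M\rangle}=L^MV_0^{\langle0\rangle}$, and let $\mathcal K^{\langle\infty\rangle}=\bigcup_{M\ge0}\mathcal K^{\langle M\rangle}$. An $M$-complex is a set $\Delta\subset\mathcal K^{\langle\infty\rangle}$ of the form $\Delta=\mathcal K^{\langle M\rangle}+\nu_\Delta$ with $\nu_\Delta=\sum_{j=M+1}^{J}L^j\nu_{i_j}$ for some $J\ge M+1$ and $i_j\in\{1,\dots,N\}$;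 its vertex set is $V(\Delta)=V_M^{\langle M\rangle}+\nu_\Delta$. For $m\ge 0$ put $V_0^{\langle m+1\rangle}=\bigcup_{i=1}^N\bigl(V_0^{\langle m\rangle}+L^{m+1}\nu_i\bigr)$, and let $V_M^{\langle\infty\rangle}=L^M\bigcup_{m\ge0}V_0^{\langle m\rangle}$. Good labelling property. Let $\mathcal A$ be an alphabet of $k$ symbols. A good labelling function of order $M\in\mathbb Z$ is a map $\ell:V_M^{\langle\infty\rangle}\to\mathcal A$ whose restriction to $V_M^{\langle M\rangle}$ is a bijection onto $\mathcal A$, and such that for every $M$-complex $\Delta=\mathcal K^{\langle M\rangle}+\nu_\Delta$ there is a rotation $R$ around the barycenter of $V_M^{\langle M\rangle}$ by an angle $2\pi n/k$, $n\in\{1,\dots,k\}$, with $\ell(v)=\ell(R(v-\nu_\Delta))$ for all $v\in V(\Delta)$. The fractal $\mathcal K^{\langle\infty\rangle}$ has the GLP if a good labelling function of order $M$ exists for some $M\in\mathbb Z$. -/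

import Mathlib

/-! Simple nested fractals in the plane and the good labelling property.
The Euclidean plane `ℝ²` is identified with `ℂ` (same distance, same inner product). -/

namespace NestedFractal

instance nonempty_perpBisector (x y : ℂ) : Nonempty (AffineSubspace.perpBisector x y) :=
  ⟨⟨midpoint ℝ x y, AffineSubspace.midpoint_mem_perpBisector x y⟩⟩

/-- A system of similitudes `Ψ i (x) = x / L + ν i`, `i = 1, …, N`, of the plane, with `L > 1`. -/
structure SimilitudeSystem where
  N : ℕ
  L : ℝ
  one_lt_L : 1 < L
  ν : Fin N → ℂ

namespace SimilitudeSystem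

variable (S : SimilitudeSystem)

/-- The `i`-th similitude. -/
noncomputable def Ψ (i : Fin S.N) (x : ℂ) : ℂ := x / (S.L : ℂ) + S.ν i

/-- `K` is the fractal generated by the system: the (unique) nonempty compact set with
`K = ⋃ i, Ψ i (K)`. -/
def IsFractal (K : Set ℂ) : Prop :=
  K.Nonempty ∧ IsCompact K ∧ K = ⋃ i, S.Ψ i '' K

/-- The set `F` of the fixed points of the similitudes. -/
def fixedPoints : Set ℂ := {x | ∃ i, S.Ψ i x = x}

/-- The set `V₀⟨0⟩` of the essential fixed points. -/
def essentialFixedPoints : Set ℂ :=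
  {x | x ∈ S.fixedPoints ∧ ∃ y ∈ S.fixedPoints, y ≠ x ∧ ∃ i j, i ≠ j ∧ S.Ψ i x = S.Ψ j y}

/-- The number `k` of the essential fixed points (they form a finite set). -/
noncomputable def k : ℕ := S.essentialFixedPoints.ncard

/-- The set `V₋₁⟨0⟩ = ⋃ i, Ψ i (V₀⟨0⟩)`. -/
def verticesNegOne : Set ℂ := ⋃ i, S.Ψ i '' S.essentialFixedPoints

/-- The graph on `V₋₁⟨0⟩` joining two distinct points lying in a common cell `Ψ i (K)`. -/
def cellGraph (K : Set ℂ) : SimpleGraph S.verticesNegOne :=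
  SimpleGraph.fromRel fun x y => ∃ i, (x : ℂ) ∈ S.Ψ i '' K ∧ (y : ℂ) ∈ S.Ψ i '' K

/-- `K` is a simple nested fractal, generated by the system `S`. -/
structure IsSimpleNestedFractal (K : Set ℂ) : Prop where
  isFractal : S.IsFractal K
  two_le : 2 ≤ S.k
  openSetCondition : ∃ U : Set ℂ, IsOpen U ∧ U.Nonempty ∧
    (∀ i j, i ≠ j → S.Ψ i '' U ∩ S.Ψ j '' U = ∅) ∧ (⋃ i, S.Ψ i '' U) ⊆ U
  nesting : ∀ i j, i ≠ j → S.Ψ i '' K ∩ S.Ψ j '' K =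
    S.Ψ i '' S.essentialFixedPoints ∩ S.Ψ j '' S.essentialFixedPoints
  symmetry : ∀ i, ∀ x ∈ S.essentialFixedPoints, ∀ y ∈ S.essentialFixedPoints, x ≠ y →
    ∃ j, EuclideanGeometry.reflection (AffineSubspace.perpBisector x y) ''
      (S.Ψ i '' S.essentialFixedPoints) = S.Ψ j '' S.essentialFixedPoints
  connected : (S.cellGraph K).Connected

/-- Multiplication by `L ^ M`, `M ∈ ℤ`. -/
noncomputable def scale (M : ℤ) (z : ℂ) : ℂ := (S.L : ℂ) ^ M * z

/-- The unbounded fractal `K⟨∞⟩ = ⋃ M ≥ 0, L ^ M K`. -/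
def unboundedFractal (K : Set ℂ) : Set ℂ := ⋃ M : ℕ, S.scale M '' K

/-- `Δ` is the `M`-complex `L ^ M K + τ`, where `τ = ∑ j = M+1, …, J, L ^ j ν (i j)` for some
`J ≥ M + 1` and some indices `i j`; it has to lie in the unbounded fractal. -/
def IsComplex (K : Set ℂ) (M : ℤ) (τ : ℂ) (Δ : Set ℂ) : Prop :=
  (∃ J : ℤ, M + 1 ≤ J ∧ ∃ i : ℤ → Fin S.N,
    τ = ∑ j ∈ Finset.Icc (M + 1) J, (S.L : ℂ) ^ j * S.ν (i j)) ∧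
  Δ = (fun z => z + τ) '' (S.scale M '' K) ∧
  Δ ⊆ S.unboundedFractal K

/-- The set `V_M⟨M⟩ = L ^ M V₀⟨0⟩` of the vertices of `K⟨M⟩ = L ^ M K`. -/
def vertices (M : ℤ) : Set ℂ := S.scale M '' S.essentialFixedPoints

/-- The set `V(Δ) = L ^ M V₀⟨0⟩ + τ` of the vertices of the `M`-complex `Δ = L ^ M K + τ`. -/
def complexVertices (M : ℤ) (τ : ℂ) : Set ℂ := (fun z => z + τ) '' S.vertices M

/-- The set `V₀⟨m⟩` of the vertices of all `0`-complexes inside `K⟨m⟩ = L ^ m K`. -/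
def innerVertices (S : SimilitudeSystem) : ℕ → Set ℂ
  | 0 => S.essentialFixedPoints
  | m + 1 => ⋃ i, (fun z => z + (S.L : ℂ) ^ (m + 1) * S.ν i) '' innerVertices S m

/-- The set `V_M⟨∞⟩ = L ^ M V₀⟨∞⟩`, where `V₀⟨∞⟩ = ⋃ m ≥ 0, V₀⟨m⟩`. -/
def allVertices (M : ℤ) : Set ℂ := S.scale M '' ⋃ m : ℕ, S.innerVertices m

/-- The barycenter of `K⟨M⟩`, i.e. of the polygon with the vertices `V_M⟨M⟩`. -/
noncomputable def barycenter (M : ℤ) : ℂ := (∑ᶠ v ∈ S.vertices M, v) / (S.k : ℂ)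

/-- The rotation by the angle `2 π n / k` around the barycenter of `K⟨M⟩`. -/
noncomputable def rotation (M : ℤ) (n : ℕ) (z : ℂ) : ℂ :=
  S.barycenter M +
    Complex.exp ((2 * Real.pi * n / S.k : ℝ) * Complex.I) * (z - S.barycenter M)

/-- Good labelling functions of order `M`, with the alphabet `Fin k` of `k` labels. -/
structure IsGoodLabelling (K : Set ℂ) (M : ℤ) (ℓ : S.allVertices M → Fin S.k) : Prop where
  bijective : Function.Bijective
    fun v : {v : S.allVertices M // (v : ℂ) ∈ S.vertices M} => ℓ v.1
  rotates : ∀ (τ : ℂ) (Δ : Set ℂ), S.IsComplex K M τ Δ →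
    ∃ n ∈ Finset.Icc 1 S.k, ∀ v w : S.allVertices M, (v : ℂ) ∈ S.complexVertices M τ →
      (w : ℂ) = S.rotation M n ((v : ℂ) - τ) → ℓ v = ℓ w

/-- The good labelling property: a good labelling of some order `M ∈ ℤ` exists. -/
def HasGLP (K : Set ℂ) : Prop :=
  ∃ (M : ℤ) (ℓ : S.allVertices M → Fin S.k), S.IsGoodLabelling K M ℓ

end SimilitudeSystem

end NestedFractal

/-! ### Regular polygons: vertices, chords, diameter, convexity. -/

namespace PolygonFractal

open Complex

/-! All cells are regular `k`-gons of circumradius 1, and two cells touch only where the difference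
of their centres is a step, i.e. a difference of two vertices realizing the diameter of the `k`-gon.
All other centres are further apart than that diameter. Then no overlap has to be excluded by hand:
two cells either are disjoint or meet in vertices only (`eq_vtx_of_isStep`,
`IsConfiguration.eq_vtx`). A finite set of centres with this separation, dihedral symmetry,
connectedness and corners `A * vtx k j` generates a simple nested fractal with `L = A + 1`
(`IsConfiguration.exists_isSimpleNestedFractal`).

A good labelling assigns to every cell a shift in `ℤ/k`. If vertex `a` of one cell is vertex `b` of
the next, the shift grows by `a - b`. A closed chain of `d` cells with constant `a - b = s`
therefore forces `k ∣ d * s` (`IsConfiguration.not_hasGLP`). Take `d` an odd prime divisor of `k`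
and the chain a regular `d`-gon of cells, whose sides are steps because `d ∣ k`. A diameter step has
`s = k / 2` for even `k` and `s = (k ± 1) / 2` for odd `k`. In the even case `k ∣ d * s` would make
`d` even; in the odd case it would give `k ∣ d`, impossible for composite `k`.

It remains to place such a ring in a symmetric configuration. A chamber of the dihedral group is a
sector of angle `π / k`. A straight row of cells joins its two walls, and the ring hangs on a short
stem from the middle of the row (`model`). The dihedral orbit of this piece is connected, because
the row meets its mirror images on the walls. It stays separated, because every centre lies on a
wall or further than half the diameter from it (`orbit_separated`). -/

/-- The primitive `k`-th root of unity `exp (2 π i / k)`. -/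
noncomputable def root (k : ℕ) : ℂ := exp (2 * Real.pi * I / k)

/-- The vertices of the regular `k`-gon inscribed in the unit circle, indexed by the integers. -/
noncomputable def vtx (k : ℕ) (a : ℤ) : ℂ := root k ^ a

/-- The regular `k`-gon inscribed in the unit circle. -/
noncomputable def polygon (k : ℕ) : Set ℂ := convexHull ℝ (Set.range (vtx k))

/-- The diameter of the regular `k`-gon inscribed in the unit circle. -/
noncomputable def width (k : ℕ) : ℝ := 2 * Real.sin (Real.pi * (k / 2 : ℕ) / k)

/-- The differences of vertices of the regular `k`-gon that realize its diameter. -/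
def IsStep (k : ℕ) (z : ℂ) : Prop := ‖z‖ = width k ∧ ∃ a b : ℤ, z = vtx k a - vtx k b

variable {k : ℕ}

theorem root_isPrimitiveRoot (hk : k ≠ 0) : IsPrimitiveRoot (root k) k :=
  Complex.isPrimitiveRoot_exp k hk

theorem root_ne_zero : root k ≠ 0 := exp_ne_zero _

theorem vtx_eq_exp (a : ℤ) : vtx k a = exp ((2 * Real.pi * a / k : ℝ) * I) := by
  rw [vtx, root, ← exp_int_mul]
  congr 1
  push_cast
  ring

theorem vtx_re (a : ℤ) : (vtx k a).re = Real.cos (2 * Real.pi * a / k) := by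
  rw [vtx_eq_exp, exp_ofReal_mul_I_re]

theorem vtx_im (a : ℤ) : (vtx k a).im = Real.sin (2 * Real.pi * a / k) := by
  rw [vtx_eq_exp, exp_ofReal_mul_I_im]

@[simp] theorem vtx_zero : vtx k 0 = 1 := by simp [vtx]

@[simp] theorem vtx_one : vtx k 1 = root k := by simp [vtx]

theorem vtx_add (a b : ℤ) : vtx k (a + b) = vtx k a * vtx k b := zpow_add₀ root_ne_zero a b

theorem vtx_ne_zero (a : ℤ) : vtx k a ≠ 0 := zpow_ne_zero _ root_ne_zero

theorem vtx_neg (a : ℤ) : vtx k (-a) = (vtx k a)⁻¹ := zpow_neg _ _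

@[simp] theorem norm_vtx (a : ℤ) : ‖vtx k a‖ = 1 := by
  rw [vtx_eq_exp, norm_exp_ofReal_mul_I]

theorem conj_vtx (a : ℤ) : (starRingEnd ℂ) (vtx k a) = vtx k (-a) := by
  rw [vtx_neg, inv_eq_conj (norm_vtx a)]

theorem vtx_eq_one_iff (hk : k ≠ 0) {a : ℤ} : vtx k a = 1 ↔ (k : ℤ) ∣ a :=
  (root_isPrimitiveRoot hk).zpow_eq_one_iff_dvd a

theorem vtx_eq_iff (hk : k ≠ 0) {a b : ℤ} : vtx k a = vtx k b ↔ (k : ℤ) ∣ a - b := by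
  rw [← vtx_eq_one_iff hk, sub_eq_add_neg, vtx_add, vtx_neg, mul_inv_eq_one₀ (vtx_ne_zero b)]

theorem exists_nat_vtx_eq (hk : k ≠ 0) (a : ℤ) : ∃ n < k, vtx k (n : ℕ) = vtx k a := by
  have hk' : (0 : ℤ) < k := by omega
  have h1 := Int.emod_nonneg a hk'.ne'
  have h2 := Int.emod_lt_of_pos a hk'
  refine ⟨(a % k).toNat, by omega, ?_⟩
  rw [vtx_eq_iff hk, Int.toNat_of_nonneg h1]
  exact ⟨-(a / k), by linarith [Int.emod_add_mul_ediv a k]⟩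

theorem vtx_natCast_injOn (hk : k ≠ 0) {a b : ℕ} (ha : a < k) (hb : b < k)
    (hab : vtx k a = vtx k b) : a = b := by
  have := Int.eq_zero_of_abs_lt_dvd ((vtx_eq_iff hk).1 hab) (by rw [abs_lt]; omega)
  omega

theorem vtx_two_mul (a : ℤ) : vtx (2 * k) (2 * a) = vtx k a := by
  rw [vtx_eq_exp, vtx_eq_exp]
  congr 3
  push_cast
  rw [mul_left_comm, mul_assoc, mul_div_mul_left _ _ two_ne_zero, mul_left_comm]

theorem vtx_mul (hk : k ≠ 0) {d e : ℕ} (h : k = d * e) (a : ℤ) : vtx d a = vtx k (e * a) := by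
  subst h
  rw [vtx_eq_exp, vtx_eq_exp]
  have he : (e : ℝ) ≠ 0 := by
    rintro h
    simp_all
  congr 3
  push_cast
  rw [mul_comm (d : ℝ), mul_left_comm, mul_div_mul_left _ _ he]

/-- Reducing `n` modulo `K` and replacing a residue `r` past the half turn by `K - r` leaves an
angle in `[2π/K, π]`, where the cosine decreases. -/
theorem cos_two_pi_mul_div_le {K : ℕ} {n : ℤ} (h : ¬ (K : ℤ) ∣ n) :
    Real.cos (2 * Real.pi * n / K) ≤ Real.cos (2 * Real.pi / K) := by
  rcases Nat.eq_zero_or_pos K with rfl | hK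
  · simp
  have hK' : (0 : ℝ) < K := by exact_mod_cast hK
  have hKz : (K : ℤ) ≠ 0 := by exact_mod_cast hK.ne'
  have hr0 : 0 ≤ n % K := Int.emod_nonneg _ hKz
  have hrK : n % K < K := Int.emod_lt_of_pos _ (by exact_mod_cast hK)
  have hr1 : 1 ≤ n % K := by
    have : n % K ≠ 0 := fun h' => h (Int.dvd_of_emod_eq_zero h')
    omega
  have hn : (n : ℝ) = (n % K : ℤ) + (K : ℝ) * (n / K : ℤ) := by
    exact_mod_cast (Int.emod_add_mul_ediv n K).symm
  have hcos : Real.cos (2 * Real.pi * n / K) = Real.cos (2 * Real.pi * (n % K : ℤ) / K) := by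
    rw [← Real.cos_add_int_mul_two_pi (2 * Real.pi * (n % K : ℤ) / K) (n / K)]
    congr 1
    rw [hn]
    field_simp
  rw [hcos]
  generalize n % (K : ℤ) = r at *
  have hpi := Real.pi_pos
  rcases le_total (2 * r) K with h2 | h2
  · have h2' : (2 * r : ℝ) ≤ K := by exact_mod_cast h2
    have hr1' : (1 : ℝ) ≤ r := by exact_mod_cast hr1
    apply Real.cos_le_cos_of_nonneg_of_le_pi (by positivity)
    · rw [div_le_iff₀ hK']; nlinarith
    · refine div_le_div_of_nonneg_right ?_ hK'.le
      nlinarith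
  · have h2' : (K : ℝ) ≤ 2 * r := by exact_mod_cast h2
    have hr1' : (r : ℝ) + 1 ≤ K := by exact_mod_cast hrK
    rw [← Real.cos_two_pi_sub]
    have : 2 * Real.pi - 2 * Real.pi * r / K = 2 * Real.pi * (K - r) / K := by field_simp
    rw [this]
    apply Real.cos_le_cos_of_nonneg_of_le_pi (by positivity)
    · rw [div_le_iff₀ hK']; nlinarith
    · refine div_le_div_of_nonneg_right ?_ hK'.le
      nlinarith

theorem norm_vtx_sub_sq (a b : ℤ) :
    ‖vtx k a - vtx k b‖ ^ 2 = 2 - 2 * Real.cos (2 * Real.pi * ((a - b : ℤ) : ℝ) / k) := by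
  have h : vtx k a - vtx k b = (vtx k (a - b) - 1) * vtx k b := by
    rw [sub_mul, ← vtx_add]; simp
  rw [h, norm_mul, norm_vtx, mul_one, ← normSq_eq_norm_sq, normSq_apply]
  simp only [sub_re, sub_im, one_re, one_im, vtx_re, vtx_im, sub_zero]
  nlinarith [Real.sin_sq_add_cos_sq (2 * Real.pi * ((a - b : ℤ) : ℝ) / k)]

theorem width_pos (hk : 2 ≤ k) : 0 < width k := by
  have hk' : (2 : ℝ) ≤ k := by exact_mod_cast hk
  have h1 : (1 : ℝ) ≤ (k / 2 : ℕ) := by exact_mod_cast (show 1 ≤ k / 2 by omega)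
  have h2 : ((k / 2 : ℕ) : ℝ) < k := by exact_mod_cast (show k / 2 < k by omega)
  have := Real.pi_pos
  refine mul_pos two_pos (Real.sin_pos_of_pos_of_lt_pi (by positivity) ?_)
  rw [div_lt_iff₀ (by linarith)]
  nlinarith

theorem width_sq (k : ℕ) :
    width k ^ 2 = 2 - 2 * Real.cos (2 * Real.pi * (k / 2 : ℕ) / k) := by
  have : 2 * Real.pi * ((k / 2 : ℕ) : ℝ) / k = 2 * (Real.pi * (k / 2 : ℕ) / k) := by ring
  rw [width, this, Real.cos_two_mul']
  nlinarith [Real.sin_sq_add_cos_sq (Real.pi * ((k / 2 : ℕ) : ℝ) / k)]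

/-- A chord depends only on the index difference `j`. For even `k` the bound is `-1 ≤ cos`. For odd
`k`, subtracting `π` turns the angle into `2π(2j - k)/(2k)`; as `2j - k` is odd, it is no multiple
of `2k`, and the bound for the `2k`-gon applies. -/
theorem norm_vtx_sub_le (hk : 2 ≤ k) (a b : ℤ) : ‖vtx k a - vtx k b‖ ≤ width k := by
  refine le_of_sq_le_sq ?_ (width_pos hk).le
  rw [norm_vtx_sub_sq, width_sq]
  generalize a - b = j
  have hk0 : (k : ℝ) ≠ 0 := by
    have : k ≠ 0 := by omega
    exact_mod_cast this
  suffices h : -Real.cos (2 * Real.pi * j / k) ≤ -Real.cos (2 * Real.pi * (k / 2 : ℕ) / k) by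
    linarith
  rcases Nat.even_or_odd' k with ⟨r, hr | hr⟩
  · have h1 : k / 2 = r := by omega
    have h2 : 2 * Real.pi * (r : ℝ) / k = Real.pi := by
      have hr0 : (r : ℝ) ≠ 0 := by
        rintro h
        simp [hr, h] at hk0
      rw [hr]
      push_cast
      field_simp
    rw [h1, h2, Real.cos_pi, neg_neg]
    linarith [Real.neg_one_le_cos (2 * Real.pi * j / k)]
  · have h1 : k / 2 = r := by omega
    have h2 : -Real.cos (2 * Real.pi * (r : ℝ) / k) = Real.cos (2 * Real.pi / (2 * k : ℕ)) := by
      rw [← Real.cos_pi_sub]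
      congr 1
      rw [hr] at hk0 ⊢
      push_cast at hk0 ⊢
      field_simp
      ring
    have h3 : -Real.cos (2 * Real.pi * j / k) =
        Real.cos (2 * Real.pi * (2 * j - k : ℤ) / (2 * k : ℕ)) := by
      rw [← Real.cos_sub_pi]
      congr 1
      push_cast
      field_simp
    rw [h1, h2, h3]
    apply cos_two_pi_mul_div_le
    rintro ⟨c, hc⟩
    push_cast at hc
    have : (2 * j - k : ℤ) = 2 * (k * c) := by linarith
    omega

theorem vtx_mem_polygon (a : ℤ) : vtx k a ∈ polygon k := subset_convexHull ℝ _ ⟨a, rfl⟩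

theorem convex_polygon : Convex ℝ (polygon k) := convex_convexHull ℝ _

theorem finite_range_vtx (hk : k ≠ 0) : (Set.range (vtx k)).Finite := by
  refine ((Set.finite_Iio k).image fun n : ℕ => vtx k n).subset ?_
  rintro _ ⟨a, rfl⟩
  exact exists_nat_vtx_eq hk a

theorem isCompact_polygon (hk : k ≠ 0) : IsCompact (polygon k) :=
  (finite_range_vtx hk).isCompact_convexHull ℝ

theorem norm_sub_vtx_le (hk : 2 ≤ k) {x : ℂ} (hx : x ∈ polygon k) (b : ℤ) :
    ‖x - vtx k b‖ ≤ width k := by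
  have : polygon k ⊆ Metric.closedBall (vtx k b) (width k) := by
    refine convexHull_min ?_ (convex_closedBall _ _)
    rintro _ ⟨a, rfl⟩
    simpa [dist_eq_norm] using norm_vtx_sub_le hk a b
  simpa [dist_eq_norm] using this hx

theorem norm_sub_le_width (hk : 2 ≤ k) {x y : ℂ} (hx : x ∈ polygon k) (hy : y ∈ polygon k) :
    ‖x - y‖ ≤ width k := by
  have : polygon k ⊆ Metric.closedBall y (width k) := by
    refine convexHull_min ?_ (convex_closedBall _ _)
    rintro _ ⟨a, rfl⟩
    rw [mem_closedBall_iff_norm, norm_sub_rev]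
    exact norm_sub_vtx_le hk hy a
  simpa [dist_eq_norm] using this hx

/-- The diameter of the polygon is realized at vertices only. -/
theorem eq_vtx_of_isStep (hk : 2 ≤ k) {x y : ℂ} (hx : x ∈ polygon k) (hy : y ∈ polygon k)
    (h : IsStep k (x - y)) : ∃ a b : ℤ, x = vtx k a ∧ y = vtx k b := by
  obtain ⟨hn, a, b, hab⟩ := h
  have h1 := norm_sub_vtx_le hk hx b
  have h2 := norm_sub_vtx_le hk hy a
  rw [norm_sub_rev] at h2
  -- Both summands have norm at most `width k` and their sum has norm twice that, so strict
  -- convexity of the norm makes them equal.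
  have h3 : ‖(x - vtx k b) + (vtx k a - y)‖ = 2 * width k := by
    have : (x - vtx k b) + (vtx k a - y) = (2 : ℝ) • (x - y) := by
      rw [real_smul]; push_cast; linear_combination -hab
    rw [this, norm_smul, hn]; simp
  have h4 : ‖x - vtx k b‖ = width k := by
    have := norm_add_le (x - vtx k b) (vtx k a - y); linarith
  have h5 : ‖vtx k a - y‖ = width k := by
    have := norm_add_le (x - vtx k b) (vtx k a - y); linarith
  have h6 : x - vtx k b = vtx k a - y :=
    eq_of_norm_eq_of_norm_add_eq (h4.trans h5.symm) (by rw [h3, h4, h5]; ring)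
  refine ⟨a, b, ?_, ?_⟩
  · linear_combination (1 / 2 : ℂ) * (h6 + hab)
  · linear_combination (1 / 2 : ℂ) * (h6 - hab)

theorem polygon_subset_closedBall : polygon k ⊆ Metric.closedBall 0 1 := by
  refine convexHull_min ?_ (convex_closedBall _ _)
  rintro _ ⟨a, rfl⟩
  simp

theorem vtx_notMem_interior (a : ℤ) : vtx k a ∉ interior (polygon k) := by
  intro h
  have := interior_mono polygon_subset_closedBall h
  rw [interior_closedBall _ one_ne_zero] at this
  simp at this

theorem sum_vtx (hk : 2 ≤ k) : ∑ a ∈ Finset.range k, vtx k a = 0 := by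
  have := (root_isPrimitiveRoot (k := k) (by omega)).geom_sum_eq_zero (by omega)
  simpa [vtx] using this

theorem zero_mem_polygon (hk : 2 ≤ k) : (0 : ℂ) ∈ polygon k := by
  have hk0 : (k : ℝ) ≠ 0 := by
    have : k ≠ 0 := by omega
    exact_mod_cast this
  have := (convex_polygon (k := k)).sum_mem (t := Finset.range k) (w := fun _ => (k : ℝ)⁻¹)
    (z := fun a => vtx k a) (fun _ _ => by positivity) (by simp [hk0])
    (fun a _ => vtx_mem_polygon a)
  rwa [← Finset.smul_sum, sum_vtx hk, smul_zero] at this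

theorem smul_add_smul_mem_polygon (hk : 2 ≤ k) {x y : ℂ} (hx : x ∈ polygon k)
    (hy : y ∈ polygon k) {s t : ℝ} (hs : 0 ≤ s) (ht : 0 ≤ t) (hst : s + t ≤ 1) :
    s * x + t * y ∈ polygon k := by
  rcases (add_nonneg hs ht).eq_or_lt with h | h
  · have hs' : s = 0 := by linarith
    have ht' : t = 0 := by linarith
    simpa [hs', ht'] using zero_mem_polygon hk
  · have h1 := convex_polygon hx hy (a := s / (s + t)) (b := t / (s + t)) (by positivity)
      (by positivity) (by rw [← add_div, div_self h.ne'])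
    have h2 := convex_polygon h1 (zero_mem_polygon hk) h.le (sub_nonneg.2 hst) (by ring)
    convert h2 using 1
    have : ((s : ℂ) + t) ≠ 0 := by exact_mod_cast h.ne'
    simp only [real_smul]
    push_cast
    field_simp
    ring

theorem mul_mem_polygon (a : ℤ) {x : ℂ} (hx : x ∈ polygon k) : vtx k a * x ∈ polygon k := by
  have : polygon k ⊆ (LinearMap.mulLeft ℝ (vtx k a)) ⁻¹' polygon k := by
    refine convexHull_min ?_ (convex_polygon.linear_preimage _)
    rintro _ ⟨b, rfl⟩
    simpa [← vtx_add] using vtx_mem_polygon (a + b)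
  exact this hx

theorem conj_mem_polygon {x : ℂ} (hx : x ∈ polygon k) : (starRingEnd ℂ) x ∈ polygon k := by
  have : polygon k ⊆ (conjAe.toLinearMap) ⁻¹' polygon k := by
    refine convexHull_min ?_ (convex_polygon.linear_preimage _)
    rintro _ ⟨b, rfl⟩
    simpa [conj_vtx] using vtx_mem_polygon (-b)
  exact this hx

theorem IsStep.vtx_mul {z : ℂ} (h : IsStep k z) (j : ℤ) : IsStep k (vtx k j * z) := by
  obtain ⟨hn, a, b, rfl⟩ := h
  refine ⟨by rw [norm_mul, norm_vtx, one_mul, hn], j + a, j + b, ?_⟩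
  rw [vtx_add, vtx_add, mul_sub]

theorem IsStep.conj {z : ℂ} (h : IsStep k z) : IsStep k ((starRingEnd ℂ) z) := by
  obtain ⟨hn, a, b, rfl⟩ := h
  exact ⟨by rw [norm_conj, hn], -a, -b, by rw [map_sub, conj_vtx, conj_vtx]⟩

theorem IsStep.neg {z : ℂ} (h : IsStep k z) : IsStep k (-z) := by
  obtain ⟨hn, a, b, rfl⟩ := h
  exact ⟨by rw [norm_neg, hn], b, a, by ring⟩

theorem sin_two_pi_div_pos (hk : 3 ≤ k) : 0 < Real.sin (2 * Real.pi / k) := by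
  have hk' : (3 : ℝ) ≤ k := by exact_mod_cast hk
  have := Real.pi_pos
  refine Real.sin_pos_of_pos_of_lt_pi (by positivity) ?_
  rw [div_lt_iff₀ (by linarith)]
  nlinarith

theorem interior_polygon_nonempty (hk : 3 ≤ k) : (interior (polygon k)).Nonempty := by
  have hs := sin_two_pi_div_pos hk
  set s := Real.sin (2 * Real.pi / k) with hs_def
  have him : (root k).im = s := by simpa using vtx_im (k := k) 1
  -- The open triangle with corners `0`, `1`, `root k`, in barycentric coordinates multiplied by
  -- `s`; its centroid is the witness.
  set O : Set ℂ := {z | 0 < z.im ∧ 0 < z.re * s - z.im * (root k).re ∧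
    (z.re * s - z.im * (root k).re) + z.im < s} with hO
  have hopen : IsOpen O := by
    simp only [hO, Set.ofPred_and]
    refine (isOpen_lt ?_ ?_).inter ((isOpen_lt ?_ ?_).inter (isOpen_lt ?_ ?_)) <;> fun_prop
  have hsub : O ⊆ polygon k := by
    rintro z ⟨h1, h2, h3⟩
    have := smul_add_smul_mem_polygon (by omega) (vtx_mem_polygon (k := k) 0)
      (vtx_mem_polygon (k := k) 1) (s := (z.re * s - z.im * (root k).re) / s) (t := z.im / s)
      (by positivity) (by positivity) (by rw [← add_div, div_le_one hs]; exact h3.le)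
    convert this using 1
    apply Complex.ext
    · simp
      field_simp
      ring
    · simp [him]
      field_simp
  refine ⟨(1 + root k) / 3, interior_maximal hsub hopen ?_⟩
  have e1 : ((1 + root k) / 3).im = s / 3 := by simp [him]
  have e2 : ((1 + root k) / 3).re = (1 + (root k).re) / 3 := by simp
  refine ⟨?_, ?_, ?_⟩ <;> rw [e1]
  · positivity
  · rw [e2]; nlinarith
  · rw [e2]; nlinarith

end PolygonFractal

/-! ### Attractors, reflections, and configurations of cells. -/

namespace PolygonFractal

open Complex NestedFractal

/-- The attractor of a system of similitudes that map a compact set into itself. -/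
theorem exists_isFractal (S : SimilitudeSystem) {P : Set ℂ} (hP : IsCompact P)
    (hmaps : ∀ i, S.Ψ i '' P ⊆ P) (hfix : ∃ x ∈ P, x ∈ S.fixedPoints) :
    ∃ K, S.IsFractal K ∧ K ⊆ P ∧ ∀ x ∈ P, x ∈ S.fixedPoints → x ∈ K := by
  set T : Set ℂ → Set ℂ := fun X => ⋃ i, S.Ψ i '' X with hT
  have hmono : Monotone T := fun X Y h => Set.iUnion_mono fun i => Set.image_mono h
  have hTP : T P ⊆ P := Set.iUnion_subset hmaps
  have hcont : ∀ i, Continuous (S.Ψ i) := fun i => by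
    unfold SimilitudeSystem.Ψ
    fun_prop
  have hinj : ∀ i, Function.Injective (S.Ψ i) := fun i x y h => by
    have hL : (S.L : ℂ) ≠ 0 := by exact_mod_cast (zero_lt_one.trans S.one_lt_L).ne'
    simpa [SimilitudeSystem.Ψ, hL] using h
  have hanti : Antitone fun n => T^[n] P := antitone_nat_of_succ_le fun n => by
    rw [Function.iterate_succ_apply]
    exact hmono.iterate n hTP
  have hcompact : ∀ n, IsCompact (T^[n] P) := fun n => by
    induction n with
    | zero => exact hP
    | succ n ih =>
      rw [Function.iterate_succ_apply']
      exact isCompact_iUnion fun i => ih.image (hcont i)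
  have hfixed : ∀ x ∈ P, x ∈ S.fixedPoints → x ∈ ⋂ n, T^[n] P := by
    rintro x hx ⟨i, hi⟩
    refine Set.mem_iInter.2 fun n => ?_
    induction n with
    | zero => exact hx
    | succ n ih =>
      rw [Function.iterate_succ_apply']
      exact Set.mem_iUnion.2 ⟨i, x, ih, hi⟩
  refine ⟨⋂ n, T^[n] P, ⟨?_, hP.of_isClosed_subset
    (isClosed_iInter fun n => (hcompact n).isClosed) (Set.iInter_subset _ 0), ?_⟩, Set.iInter_subset _ 0, hfixed⟩
  · obtain ⟨x, hx, hx'⟩ := hfix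
    exact ⟨x, hfixed x hx hx'⟩
  · apply Set.Subset.antisymm
    · intro x hx
      have h1 : ∀ n, ∃ i, x ∈ S.Ψ i '' (T^[n] P) := fun n => by
        have := Set.mem_iInter.1 hx (n + 1)
        rw [Function.iterate_succ_apply'] at this
        exact Set.mem_iUnion.1 this
      choose f hf using h1
      -- Pigeonhole: one index `i` works for infinitely many `n`, hence for all, since the iterates
      -- decrease; injectivity of `Ψ i` then gives one common preimage.
      obtain ⟨i, hi⟩ := Finite.exists_infinite_fiber f
      rw [Set.infinite_coe_iff] at hi
      have h2 : ∀ n, x ∈ S.Ψ i '' (T^[n] P) := fun n => by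
        obtain ⟨m, hm, hnm⟩ := hi.exists_gt n
        have hfm : f m = i := hm
        exact Set.image_mono (hanti hnm.le) (hfm ▸ hf m)
      obtain ⟨y, -, rfl⟩ := h2 0
      refine Set.mem_iUnion.2 ⟨i, y, Set.mem_iInter.2 fun n => ?_, rfl⟩
      obtain ⟨z, hz, hzy⟩ := h2 n
      rwa [← hinj i hzy]
    · refine Set.iUnion_subset fun i => ?_
      rintro _ ⟨x, hx, rfl⟩
      refine Set.mem_iInter.2 fun n => ?_
      rcases n with - | n
      · exact hmaps i ⟨x, Set.mem_iInter.1 hx 0, rfl⟩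
      · rw [Function.iterate_succ_apply']
        exact Set.mem_iUnion.2 ⟨i, x, Set.mem_iInter.1 hx n, rfl⟩

theorem reflection_perpBisector_eq {x y z z' : ℂ}
    (hmid : midpoint ℝ z z' ∈ AffineSubspace.perpBisector x y)
    (hdir : ∃ r : ℝ, z - z' = r * (y - x)) :
    EuclideanGeometry.reflection (AffineSubspace.perpBisector x y) z = z' := by
  obtain ⟨r, hr⟩ := hdir
  have hv : (1 / 2 : ℝ) • (z - z') ∈ (AffineSubspace.perpBisector x y).directionᗮ := by
    rw [AffineSubspace.direction_perpBisector]
    apply Submodule.le_orthogonal_orthogonal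
    rw [hr, ← real_smul, smul_smul, vsub_eq_sub]
    exact Submodule.smul_mem _ _ (Submodule.mem_span_singleton_self _)
  have h := EuclideanGeometry.reflection_orthogonal_vadd hmid hv
  have h1 : (1 / 2 : ℝ) • (z - z') +ᵥ midpoint ℝ z z' = z := by
    rw [midpoint_eq_smul_add]
    simp only [vadd_eq_add, real_smul, invOf_eq_inv]
    push_cast
    ring
  have h2 : -((1 / 2 : ℝ) • (z - z')) +ᵥ midpoint ℝ z z' = z' := by
    rw [midpoint_eq_smul_add]
    simp only [vadd_eq_add, real_smul, invOf_eq_inv]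
    push_cast
    ring
  rwa [h1, h2] at h

variable {k : ℕ}

/-- Reflections of the polygon fix its centre, so they have the form `z ↦ vtx k (a + b) * conj z`.
The shift by `1` occurs because the polygon is translated to have a vertex at the origin. -/
theorem reflection_vtx {a b : ℤ} (h : vtx k a ≠ vtx k b) (z : ℂ) :
    EuclideanGeometry.reflection (AffineSubspace.perpBisector (vtx k a - 1) (vtx k b - 1))
      (z - 1) = vtx k (a + b) * (starRingEnd ℂ) z - 1 := by
  have hab : vtx k b - vtx k a ≠ 0 := sub_ne_zero.2 h.symm
  have ha := vtx_ne_zero (k := k) a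
  have hb := vtx_ne_zero (k := k) b
  apply reflection_perpBisector_eq
  · set p := (z + vtx k (a + b) * (starRingEnd ℂ) z) / 2 with hp
    have h1 : midpoint ℝ (z - 1) (vtx k (a + b) * (starRingEnd ℂ) z - 1) = p - 1 := by
      rw [midpoint_eq_smul_add]
      simp only [real_smul, invOf_eq_inv]
      push_cast
      ring
    rw [h1, AffineSubspace.mem_perpBisector_iff_dist_eq, dist_eq_norm, dist_eq_norm,
      sub_sub_sub_cancel_right, sub_sub_sub_cancel_right]
    have h2 : p - vtx k b = vtx k (a + b) * (starRingEnd ℂ) (p - vtx k a) := by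
      simp only [hp, map_sub, map_div₀, map_add, map_mul, conj_conj, conj_vtx, vtx_neg, vtx_add,
        map_ofNat]
      field_simp
      ring
    rw [h2, norm_mul, norm_vtx, one_mul, norm_conj]
  · obtain ⟨r, hr⟩ := conj_eq_iff_real.1 (show (starRingEnd ℂ)
        ((z - vtx k (a + b) * (starRingEnd ℂ) z) / (vtx k b - vtx k a)) =
        (z - vtx k (a + b) * (starRingEnd ℂ) z) / (vtx k b - vtx k a) by
      have hab' : vtx k a - vtx k b ≠ 0 := sub_ne_zero.2 h
      have e1 : (vtx k b)⁻¹ - (vtx k a)⁻¹ = (vtx k a - vtx k b) / (vtx k a * vtx k b) := by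
        field_simp
      simp only [map_sub, map_div₀, map_mul, conj_conj, conj_vtx, vtx_neg, vtx_add, e1]
      field_simp
      ring)
    refine ⟨r, ?_⟩
    rw [← hr]
    field_simp
    ring

/-- A finite set of centres of unit regular `k`-gons with the symmetry of the regular `k`-gon, such
that the `k`-gons meet at vertices only, form a connected chain, and fit into a regular `k`-gon of
circumradius `A + 1`. -/
structure IsConfiguration (k : ℕ) (A : ℝ) (C : Finset ℂ) : Prop where
  pos : 0 < A
  corner_mem : (A : ℂ) ∈ C
  root_mul_mem : ∀ c ∈ C, root k * c ∈ C
  conj_mem : ∀ c ∈ C, (starRingEnd ℂ) c ∈ C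
  div_mem_polygon : ∀ c ∈ C, c / A ∈ polygon k
  separated : ∀ c ∈ C, ∀ c' ∈ C, c ≠ c' → width k < ‖c - c'‖ ∨ IsStep k (c - c')
  connected : ∀ c ∈ C, Relation.ReflTransGen (fun x y => y ∈ C ∧ IsStep k (y - x)) A c

/-- The system of similitudes that map a `k`-gon of circumradius `1` with a vertex at the origin
to the cells with the centres in `C`. -/
noncomputable def system (A : ℝ) (hA : 0 < A) (C : Finset ℂ) : SimilitudeSystem where
  N := C.card
  L := A + 1
  one_lt_L := by linarith
  ν i := ((C.equivFin.symm i : ℂ) - A) / (A + 1)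

namespace IsConfiguration

variable {A : ℝ} {C : Finset ℂ} (h : IsConfiguration k A C)
include h

theorem vtx_mul_mem (a : ℤ) {c : ℂ} (hc : c ∈ C) (hk : k ≠ 0) : vtx k a * c ∈ C := by
  have h1 : ∀ n : ℕ, vtx k n * c ∈ C := fun n => by
    induction n with
    | zero => simpa using hc
    | succ n ih =>
      rw [Nat.cast_succ, add_comm, vtx_add, vtx_one, mul_assoc]
      exact h.root_mul_mem _ ih
  obtain ⟨n, -, hn⟩ := exists_nat_vtx_eq hk a
  rw [← hn]
  exact h1 n

end IsConfiguration

end PolygonFractal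

/-! ### The similitudes in centred coordinates, and their essential fixed points. -/

namespace PolygonFractal

open Complex NestedFractal

variable {k : ℕ} {A : ℝ} {hA : 0 < A} {C : Finset ℂ}

/-- The centre of the `i`-th cell, the polygon being scaled to circumradius `A + 1`. -/
noncomputable def center (i : Fin (system A hA C).N) : ℂ :=
  C.equivFin.symm (i : Fin C.card)

theorem center_mem (i : Fin (system A hA C).N) : center i ∈ C :=
  (C.equivFin.symm (i : Fin C.card)).2

theorem center_injective : Function.Injective (center (hA := hA) (C := C)) := fun _ _ h =>
  C.equivFin.symm.injective (Subtype.ext h)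

theorem exists_center_eq (hA : 0 < A) {c : ℂ} (hc : c ∈ C) :
    ∃ i : Fin (system A hA C).N, center i = c :=
  ⟨C.equivFin ⟨c, hc⟩, by simp [center]⟩

theorem system_ν (i : Fin (system A hA C).N) :
    (system A hA C).ν i = (center i - A) / (A + 1) := rfl

theorem system_L : (system A hA C).L = A + 1 := rfl

/-- With the coordinate `x` measured from the centre of the polygon, the similitude is `x ↦ (x +
center i) / (A + 1)`; later computations use this form. -/
theorem system_Ψ_sub_one (i : Fin (system A hA C).N) (x : ℂ) :
    (system A hA C).Ψ i (x - 1) = (x + center i) / (A + 1 : ℝ) - 1 := by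
  have : (A + 1 : ℂ) ≠ 0 := by exact_mod_cast (by linarith : A + 1 ≠ 0)
  simp only [SimilitudeSystem.Ψ, system_ν, system_L]
  push_cast
  field_simp
  ring

theorem system_Ψ_eq_iff {i j : Fin (system A hA C).N} {x y : ℂ} :
    (system A hA C).Ψ i (x - 1) = (system A hA C).Ψ j (y - 1) ↔
      x + center i = y + center j := by
  have : ((A + 1 : ℝ) : ℂ) ≠ 0 := by exact_mod_cast (by linarith : A + 1 ≠ 0)
  rw [system_Ψ_sub_one, system_Ψ_sub_one, sub_left_inj, div_left_inj' this]

theorem sub_one_mem_fixedPoints_iff {x : ℂ} :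
    x - 1 ∈ (system A hA C).fixedPoints ↔ A * x ∈ C := by
  have h1 : ((A + 1 : ℝ) : ℂ) ≠ 0 := by exact_mod_cast (by linarith : A + 1 ≠ 0)
  have h2 : ∀ i : Fin (system A hA C).N, (system A hA C).Ψ i (x - 1) = x - 1 ↔
      center i = A * x := fun i => by
    rw [system_Ψ_sub_one, sub_left_inj, div_eq_iff h1]
    push_cast
    constructor <;> intro h <;> linear_combination h
  constructor
  · rintro ⟨i, hi⟩
    rw [← (h2 i).1 hi]
    exact center_mem i
  · intro hx
    obtain ⟨i, hi⟩ := exists_center_eq hA hx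
    exact ⟨i, (h2 i).2 hi⟩

namespace IsConfiguration

variable (h : IsConfiguration k A C)
include h

theorem mem_polygon {x : ℂ} (hx : A * x ∈ C) : x ∈ polygon k := by
  have hA : (A : ℂ) ≠ 0 := by exact_mod_cast h.pos.ne'
  simpa [hA] using h.div_mem_polygon _ hx

/-- Distinct cells meet at vertices only. -/
theorem eq_vtx (hk : 2 ≤ k) {c c' x y : ℂ} (hc : c ∈ C) (hc' : c' ∈ C) (hne : c ≠ c')
    (hx : x ∈ polygon k) (hy : y ∈ polygon k) (hxy : x + c = y + c') :
    ∃ a b : ℤ, x = vtx k a ∧ y = vtx k b := by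
  have h1 : c - c' = y - x := by linear_combination hxy
  have h2 := norm_sub_le_width hk hy hx
  rcases h.separated c hc c' hc' hne with h3 | h3
  · rw [h1] at h3
    exact absurd h3 h2.not_gt
  · rw [h1] at h3
    obtain ⟨a, b, ha, hb⟩ := eq_vtx_of_isStep hk hy hx h3
    exact ⟨b, a, hb, ha⟩

/-- The corners `A` and `root k * A` differ, so the chain joining them has a first step. -/
theorem exists_step (hk : 2 ≤ k) : ∃ c ∈ C, ∃ c' ∈ C, IsStep k (c' - c) := by
  have h1 : vtx k 1 * (A : ℂ) ∈ C := h.vtx_mul_mem 1 h.corner_mem (by omega)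
  have hne : (A : ℂ) ≠ vtx k 1 * A := by
    intro h2
    have hA : (A : ℂ) ≠ 0 := by exact_mod_cast h.pos.ne'
    have h3 : vtx k 1 = 1 := by
      have : (vtx k 1 - 1) * (A : ℂ) = 0 := by linear_combination -h2
      simpa [hA, sub_eq_zero] using this
    rw [vtx_eq_one_iff (by omega)] at h3
    have := Int.le_of_dvd one_pos h3
    omega
  rcases (Relation.ReflTransGen.cases_head_iff.1 (h.connected _ h1)) with h2 | ⟨c, ⟨hc, hs⟩, -⟩
  · exact absurd h2 hne
  · exact ⟨A, h.corner_mem, c, hc, hs⟩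

/-- Distinct cells share only vertices, which gives one inclusion. For the other, one touching pair
of cells exists, and a rotation gives its contact vertex any prescribed index. -/
theorem essentialFixedPoints_eq (hk : 2 ≤ k) :
    (system A h.pos C).essentialFixedPoints = Set.range fun a : ℤ => vtx k a - 1 := by
  have hk0 : k ≠ 0 := by omega
  apply Set.Subset.antisymm
  · rintro x ⟨hx, y, hy, hxy, i, j, hij, hΨ⟩
    obtain ⟨x, rfl⟩ : ∃ x', x = x' - 1 := ⟨x + 1, by ring⟩
    obtain ⟨y, rfl⟩ : ∃ y', y = y' - 1 := ⟨y + 1, by ring⟩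
    rw [system_Ψ_eq_iff] at hΨ
    rw [sub_one_mem_fixedPoints_iff] at hx hy
    obtain ⟨a, -, ha, -⟩ := h.eq_vtx hk (center_mem i) (center_mem j) (center_injective.ne hij)
      (h.mem_polygon hx) (h.mem_polygon hy) hΨ
    exact ⟨a, by rw [ha]⟩
  · rintro _ ⟨a, rfl⟩
    have hfix : ∀ b : ℤ, vtx k b - 1 ∈ (system A h.pos C).fixedPoints := fun b => by
      rw [sub_one_mem_fixedPoints_iff, mul_comm]
      exact h.vtx_mul_mem b h.corner_mem hk0
    obtain ⟨c, hc, c', hc', hn, x, y, hxy⟩ := h.exists_step hk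
    have hw := width_pos hk
    have hcc : c' ≠ c := by
      rintro rfl
      simp at hn
      linarith
    have hvne : vtx k (y - x + a) ≠ vtx k a := by
      intro h'
      apply hcc
      have h3 : vtx k x = vtx k y := by
        rw [vtx_eq_iff hk0] at h' ⊢
        rwa [show x - y = -(y - x + a - a) by ring, dvd_neg]
      rwa [h3, sub_self, sub_eq_zero] at hxy
    refine ⟨hfix a, vtx k (y - x + a) - 1, hfix _, fun h' => hvne (sub_left_injective h'), ?_⟩
    obtain ⟨i, hi⟩ := exists_center_eq h.pos (h.vtx_mul_mem (a - x) hc hk0)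
    obtain ⟨j, hj⟩ := exists_center_eq h.pos (h.vtx_mul_mem (a - x) hc' hk0)
    refine ⟨i, j, ?_, ?_⟩
    · rintro rfl
      exact hcc (mul_left_cancel₀ (vtx_ne_zero (a - x)) (hj.symm.trans hi))
    · rw [system_Ψ_eq_iff, hi, hj]
      have e1 : vtx k a = vtx k (a - x) * vtx k x := by rw [← vtx_add]; congr 1; ring
      have e2 : vtx k (y - x + a) = vtx k (a - x) * vtx k y := by rw [← vtx_add]; congr 1; ring
      rw [e1, e2]
      linear_combination -vtx k (a - x) * hxy

theorem system_k (hk : 2 ≤ k) : (system A h.pos C).k = k := by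
  have hk0 : k ≠ 0 := by omega
  have h1 : (Set.range fun a : ℤ => vtx k a - 1) =
      (fun a : ℕ => vtx k a - 1) '' (Finset.range k : Set ℕ) := by
    apply Set.Subset.antisymm
    · rintro _ ⟨a, rfl⟩
      obtain ⟨n, hn, hna⟩ := exists_nat_vtx_eq hk0 a
      exact ⟨n, by simpa using hn, by simp only [hna]⟩
    · rintro _ ⟨a, -, rfl⟩
      exact ⟨a, rfl⟩
  rw [SimilitudeSystem.k, h.essentialFixedPoints_eq hk, h1, Set.InjOn.ncard_image,
    Set.ncard_coe_finset, Finset.card_range]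
  intro a ha b hb hab
  simp only [Finset.coe_range, Set.mem_Iio] at ha hb
  exact vtx_natCast_injOn hk0 ha hb (sub_left_injective hab)

end IsConfiguration

end PolygonFractal

/-! ### The axioms of a simple nested fractal. -/

namespace PolygonFractal

open Complex NestedFractal

variable {k : ℕ} {A : ℝ} {C : Finset ℂ}

namespace IsConfiguration

variable (h : IsConfiguration k A C)
include h

/-- `(x + c) / (A + 1)` is the convex combination of `x` and `c / A` with weights `1 / (A + 1)` and
`A / (A + 1)`. -/
theorem Ψ_image_subset (hk : 2 ≤ k) (i : Fin (system A h.pos C).N) :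
    (system A h.pos C).Ψ i '' ((· - 1) '' polygon k) ⊆ (· - 1) '' polygon k := by
  rintro _ ⟨_, ⟨x, hx, rfl⟩, rfl⟩
  refine ⟨_, ?_, (system_Ψ_sub_one i x).symm⟩
  have hA := h.pos
  have hA' : (A : ℂ) ≠ 0 := by exact_mod_cast hA.ne'
  have hA1 : (A + 1 : ℂ) ≠ 0 := by exact_mod_cast (by linarith : A + 1 ≠ 0)
  have h1 := smul_add_smul_mem_polygon hk hx (h.div_mem_polygon _ (center_mem i))
    (s := 1 / (A + 1)) (t := A / (A + 1)) (by positivity) (by positivity)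
    (by field_simp; linarith)
  convert h1 using 1
  push_cast
  field_simp

theorem exists_fractal (hk : 2 ≤ k) : ∃ K, (system A h.pos C).IsFractal K ∧
    K ⊆ (· - 1) '' polygon k ∧ (system A h.pos C).essentialFixedPoints ⊆ K := by
  have hess : (system A h.pos C).essentialFixedPoints ⊆ (· - 1) '' polygon k := by
    rw [h.essentialFixedPoints_eq hk]
    rintro _ ⟨a, rfl⟩
    exact ⟨_, vtx_mem_polygon a, rfl⟩
  have hmem : (0 : ℂ) ∈ (system A h.pos C).essentialFixedPoints := by
    rw [h.essentialFixedPoints_eq hk]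
    exact ⟨0, by simp⟩
  obtain ⟨K, hK, hKP, hfix⟩ := exists_isFractal (system A h.pos C)
    (P := (· - 1) '' polygon k) ((isCompact_polygon (by omega)).image (by fun_prop))
    (fun i => h.Ψ_image_subset hk i) ⟨0, hess hmem, hmem.1⟩
  exact ⟨K, hK, hKP, fun x hx => hfix x (hess hx) hx.1⟩

/-- The interior of the polygon works: cells share only vertices, and vertices lie on the unit
circle, hence not in the interior. -/
theorem openSetCondition (hk : 3 ≤ k) : ∃ U : Set ℂ, IsOpen U ∧ U.Nonempty ∧
    (∀ i j, i ≠ j → (system A h.pos C).Ψ i '' U ∩ (system A h.pos C).Ψ j '' U = ∅) ∧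
    (⋃ i, (system A h.pos C).Ψ i '' U) ⊆ U := by
  have hA1 : ((A + 1 : ℝ) : ℂ) ≠ 0 := by exact_mod_cast (by linarith [h.pos] : A + 1 ≠ 0)
  have himage : ∀ X : Set ℂ, IsOpen X → IsOpen ((fun x => x - 1) '' X) := fun X hX =>
    (Homeomorph.subRight (1 : ℂ)).isOpenMap X hX
  have hΨ : ∀ (i : Fin (system A h.pos C).N) (X : Set ℂ), IsOpen X →
      IsOpen ((fun x => (x + center i) / ((A + 1 : ℝ) : ℂ)) '' X) := fun i X hX =>
    ((Homeomorph.addRight (center i)).trans (Homeomorph.mulRight₀ _ (inv_ne_zero hA1))).isOpenMap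
      X hX
  refine ⟨(· - 1) '' interior (polygon k), himage _ isOpen_interior,
    (interior_polygon_nonempty hk).image _, ?_, ?_⟩
  · intro i j hij
    rw [Set.eq_empty_iff_forall_notMem]
    rintro _ ⟨⟨_, ⟨x, hx, rfl⟩, rfl⟩, ⟨_, ⟨y, hy, rfl⟩, hxy⟩⟩
    have hxy' := (system_Ψ_eq_iff.1 hxy).symm
    obtain ⟨a, b, ha, -⟩ := h.eq_vtx (by omega) (center_mem i) (center_mem j)
      (center_injective.ne hij) (interior_subset hx) (interior_subset hy) hxy'
    exact vtx_notMem_interior a (ha ▸ hx)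
  · refine Set.iUnion_subset fun i => ?_
    rintro _ ⟨_, ⟨x, hx, rfl⟩, rfl⟩
    refine ⟨_, ?_, (system_Ψ_sub_one i x).symm⟩
    refine interior_maximal ?_ (hΨ i _ isOpen_interior) ⟨x, hx, rfl⟩
    rintro _ ⟨y, hy, rfl⟩
    obtain ⟨z, hz, hzy⟩ := h.Ψ_image_subset (by omega) i
      ⟨_, ⟨y, interior_subset hy, rfl⟩, rfl⟩
    rw [system_Ψ_sub_one] at hzy
    have hzy' : z = (y + center i) / ((A + 1 : ℝ) : ℂ) := sub_left_injective hzy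
    simpa only [← hzy'] using hz

theorem nesting (hk : 2 ≤ k) {K : Set ℂ} (hKP : K ⊆ (· - 1) '' polygon k)
    (hVK : (system A h.pos C).essentialFixedPoints ⊆ K) {i j : Fin (system A h.pos C).N}
    (hij : i ≠ j) : (system A h.pos C).Ψ i '' K ∩ (system A h.pos C).Ψ j '' K =
      (system A h.pos C).Ψ i '' (system A h.pos C).essentialFixedPoints ∩
      (system A h.pos C).Ψ j '' (system A h.pos C).essentialFixedPoints := by
  apply Set.Subset.antisymm
  · rintro _ ⟨⟨x, hx, rfl⟩, ⟨y, hy, hxy⟩⟩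
    obtain ⟨x, hxP, rfl⟩ := hKP hx
    obtain ⟨y, hyP, rfl⟩ := hKP hy
    obtain ⟨a, b, rfl, rfl⟩ := h.eq_vtx hk (center_mem i) (center_mem j)
      (center_injective.ne hij) hxP hyP (system_Ψ_eq_iff.1 hxy).symm
    rw [h.essentialFixedPoints_eq hk]
    exact ⟨⟨_, ⟨a, rfl⟩, rfl⟩, ⟨_, ⟨b, rfl⟩, hxy⟩⟩
  · exact Set.inter_subset_inter (Set.image_mono hVK) (Set.image_mono hVK)

theorem symmetry (hk : 2 ≤ k) (i : Fin (system A h.pos C).N) {x y : ℂ}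
    (hx : x ∈ (system A h.pos C).essentialFixedPoints)
    (hy : y ∈ (system A h.pos C).essentialFixedPoints) (hxy : x ≠ y) :
    ∃ j, EuclideanGeometry.reflection (AffineSubspace.perpBisector x y) ''
      ((system A h.pos C).Ψ i '' (system A h.pos C).essentialFixedPoints) =
      (system A h.pos C).Ψ j '' (system A h.pos C).essentialFixedPoints := by
  rw [h.essentialFixedPoints_eq hk] at hx hy ⊢
  obtain ⟨a, rfl⟩ := hx
  obtain ⟨b, rfl⟩ := hy
  have hab : vtx k a ≠ vtx k b := fun h' => hxy (by simp only [h'])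
  -- The reflection acts on centres by the same formula as on vertices, and `C` is closed under it.
  obtain ⟨j, hj⟩ := exists_center_eq h.pos
    (h.vtx_mul_mem (a + b) (h.conj_mem _ (center_mem i)) (by omega))
  have key : ∀ n : ℤ, EuclideanGeometry.reflection
      (AffineSubspace.perpBisector (vtx k a - 1) (vtx k b - 1))
      ((system A h.pos C).Ψ i (vtx k n - 1)) =
      (system A h.pos C).Ψ j (vtx k (a + b - n) - 1) := fun n => by
    rw [system_Ψ_sub_one, system_Ψ_sub_one, reflection_vtx hab, hj, map_div₀, map_add, conj_vtx,
      conj_ofReal, sub_eq_add_neg (a + b), vtx_add (a + b)]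
    ring
  refine ⟨j, Set.Subset.antisymm ?_ ?_⟩
  · rintro _ ⟨_, ⟨_, ⟨n, rfl⟩, rfl⟩, rfl⟩
    exact ⟨_, ⟨a + b - n, rfl⟩, (key n).symm⟩
  · rintro _ ⟨_, ⟨n, rfl⟩, rfl⟩
    refine ⟨_, ⟨_, ⟨a + b - n, rfl⟩, rfl⟩, ?_⟩
    rw [key, sub_sub_cancel]

theorem cellGraph_connected (hk : 2 ≤ k) {K : Set ℂ}
    (hVK : (system A h.pos C).essentialFixedPoints ⊆ K) :
    ((system A h.pos C).cellGraph K).Connected := by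
  set S := system A h.pos C with hS
  have hV := h.essentialFixedPoints_eq hk
  have hcell : ∀ (i : Fin S.N) (x y : S.verticesNegOne), (x : ℂ) ∈ S.Ψ i '' K →
      (y : ℂ) ∈ S.Ψ i '' K → (S.cellGraph K).Reachable x y := fun i x y hx hy => by
    by_cases hxy : x = y
    · rw [hxy]
    · exact SimpleGraph.Adj.reachable
        ((SimpleGraph.fromRel_adj _ _ _).2 ⟨hxy, Or.inl ⟨i, hx, hy⟩⟩)
  obtain ⟨i₀, hi₀⟩ := exists_center_eq h.pos h.corner_mem
  have hreach : ∀ c, Relation.ReflTransGen (fun x y => y ∈ C ∧ IsStep k (y - x)) (A : ℂ) c →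
      ∀ j : Fin S.N, center j = c → ∀ x y : S.verticesNegOne, (x : ℂ) ∈ S.Ψ i₀ '' K →
      (y : ℂ) ∈ S.Ψ j '' K → (S.cellGraph K).Reachable x y := fun c hc => by
    induction hc with
    | refl =>
      intro j hj x y hx hy
      obtain rfl := center_injective (hj.trans hi₀.symm)
      exact hcell _ x y hx hy
    | @tail b c hb hbc ih =>
      obtain ⟨hc, -, m, n, hmn⟩ := hbc
      intro j hj x y hx hy
      have hbC : b ∈ C := by
        rcases Relation.ReflTransGen.cases_tail_iff _ _ _ |>.1 hb with h' | ⟨_, -, h', -⟩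
        · exact h' ▸ h.corner_mem
        · exact h'
      obtain ⟨j', hj'⟩ := exists_center_eq h.pos hbC
      have hmem : ∀ l : ℤ, vtx k l - 1 ∈ S.essentialFixedPoints := fun l => by
        rw [hV]
        exact ⟨l, rfl⟩
      have hz : S.Ψ j (vtx k n - 1) = S.Ψ j' (vtx k m - 1) := by
        refine system_Ψ_eq_iff.2 ?_
        rw [hj, hj']
        linear_combination hmn
      let z : S.verticesNegOne :=
        ⟨S.Ψ j (vtx k n - 1), Set.mem_iUnion.2 ⟨j, _, hmem n, rfl⟩⟩
      have h1 := ih j' hj' x z hx ⟨_, hVK (hmem m), hz.symm⟩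
      exact h1.trans (hcell j z y ⟨_, hVK (hmem n), rfl⟩ hy)
  have hne : S.essentialFixedPoints.Nonempty := by
    rw [hV]
    exact ⟨_, 0, rfl⟩
  obtain ⟨v, hv⟩ := hne
  let x₀ : S.verticesNegOne := ⟨S.Ψ i₀ v, Set.mem_iUnion.2 ⟨i₀, v, hv, rfl⟩⟩
  have hx₀ : ∀ y : S.verticesNegOne, (S.cellGraph K).Reachable x₀ y := by
    rintro ⟨y, hy⟩
    obtain ⟨j, w, hw, rfl⟩ := Set.mem_iUnion.1 hy
    exact hreach _ (h.connected _ (center_mem j)) j rfl _ _ ⟨v, hVK hv, rfl⟩ ⟨w, hVK hw, rfl⟩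
  have : Nonempty S.verticesNegOne := ⟨x₀⟩
  exact ⟨fun x y => (hx₀ x).symm.trans (hx₀ y)⟩

theorem exists_isSimpleNestedFractal (hk : 3 ≤ k) :
    ∃ K, (system A h.pos C).IsSimpleNestedFractal K := by
  have hk2 : 2 ≤ k := by omega
  obtain ⟨K, hK, hKP, hVK⟩ := h.exists_fractal hk2
  exact ⟨K, hK, (h.system_k hk2).symm ▸ hk2, h.openSetCondition hk,
    fun i j hij => h.nesting hk2 hKP hVK hij, fun i x hx y hy hxy => h.symmetry hk2 i hx hy hxy,
    h.cellGraph_connected hk2 hVK⟩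

end IsConfiguration

end PolygonFractal

/-! ### The obstruction to good labellings. -/

namespace PolygonFractal

open Complex NestedFractal

variable {k : ℕ} {A : ℝ} {C : Finset ℂ}

namespace IsConfiguration

variable (h : IsConfiguration k A C)
include h

/-- For negative `M` this rests on the corner cell: its translation is `0`, so `K` is stable under
division by `L`. -/
theorem scale_image_subset_unboundedFractal {K : Set ℂ} (hK : (system A h.pos C).IsFractal K)
    (M : ℤ) : (system A h.pos C).scale M '' K ⊆ (system A h.pos C).unboundedFractal K := by
  set S := system A h.pos C with hS
  have hL : (S.L : ℂ) ≠ 0 := by exact_mod_cast (zero_lt_one.trans S.one_lt_L).ne'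
  rintro _ ⟨x, hx, rfl⟩
  rcases M with n | n
  · exact Set.mem_iUnion.2 ⟨n, x, hx, rfl⟩
  · obtain ⟨i, hi⟩ := exists_center_eq h.pos h.corner_mem
    have hmaps : ∀ y ∈ K, y / (S.L : ℂ) ∈ K := fun y hy => by
      rw [hK.2.2]
      refine Set.mem_iUnion.2 ⟨i, y, hy, ?_⟩
      rw [SimilitudeSystem.Ψ, system_ν, hi, sub_self, zero_div, add_zero]
    have hpow : ∀ m : ℕ, x / (S.L : ℂ) ^ m ∈ K := fun m => by
      induction m with
      | zero => simpa using hx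
      | succ m ih => simpa [pow_succ, div_div] using hmaps _ ih
    refine Set.mem_iUnion.2 ⟨0, _, hpow (n + 1), ?_⟩
    simp only [SimilitudeSystem.scale, zpow_negSucc, Nat.cast_zero, zpow_zero, one_mul]
    rw [div_eq_inv_mul]

theorem vertices_eq (hk : 2 ≤ k) (M : ℤ) : (system A h.pos C).vertices M =
    Set.range fun a : ℤ => ((system A h.pos C).L : ℂ) ^ M * (vtx k a - 1) := by
  rw [SimilitudeSystem.vertices, h.essentialFixedPoints_eq hk, ← Set.range_comp]
  rfl

theorem barycenter_eq (hk : 2 ≤ k) (M : ℤ) :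
    (system A h.pos C).barycenter M = -((system A h.pos C).L : ℂ) ^ M := by
  set S := system A h.pos C with hS
  have hk0 : k ≠ 0 := by omega
  have hk0' : (k : ℂ) ≠ 0 := by exact_mod_cast hk0
  have hL : (S.L : ℂ) ^ M ≠ 0 :=
    zpow_ne_zero _ (by exact_mod_cast (zero_lt_one.trans S.one_lt_L).ne')
  have h1 : S.vertices M =
      (fun a : ℕ => (S.L : ℂ) ^ M * (vtx k a - 1)) '' (Finset.range k : Set ℕ) := by
    rw [hS, h.vertices_eq hk]
    apply Set.Subset.antisymm
    · rintro _ ⟨a, rfl⟩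
      obtain ⟨n, hn, hna⟩ := exists_nat_vtx_eq hk0 a
      exact ⟨n, by simpa using hn, by simp only [hna]⟩
    · rintro _ ⟨a, -, rfl⟩
      exact ⟨a, rfl⟩
  have hinj : Set.InjOn (fun a : ℕ => (S.L : ℂ) ^ M * (vtx k a - 1))
      (Finset.range k : Set ℕ) := by
    intro a ha b hb hab
    simp only [Finset.coe_range, Set.mem_Iio] at ha hb
    exact vtx_natCast_injOn hk0 ha hb (sub_left_injective (mul_left_cancel₀ hL hab))
  rw [SimilitudeSystem.barycenter, h1, finsum_mem_image hinj, finsum_mem_coe_finset,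
    ← Finset.mul_sum, Finset.sum_sub_distrib, sum_vtx hk, hS, h.system_k hk]
  simp
  field_simp

theorem rotation_eq (hk : 2 ≤ k) (M : ℤ) (n : ℕ) (a : ℤ) :
    (system A h.pos C).rotation M n (((system A h.pos C).L : ℂ) ^ M * (vtx k a - 1)) =
      ((system A h.pos C).L : ℂ) ^ M * (vtx k (a + n) - 1) := by
  have : exp ((2 * Real.pi * n / k : ℝ) * I) = vtx k n := by rw [vtx_eq_exp]; norm_cast
  rw [SimilitudeSystem.rotation, h.barycenter_eq hk, h.system_k hk, this, vtx_add]
  ring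

/-- A closed chain of cells with a nontrivial total rotation of the labels rules out the good
labelling property. -/
theorem not_hasGLP (hk : 2 ≤ k) {K : Set ℂ} (hK : (system A h.pos C).IsFractal K) {d : ℕ} {s : ℤ}
    {c : ℕ → ℂ} {a b : ℕ → ℤ} (hc : ∀ l, c l ∈ C) (hclosed : c d = c 0)
    (hstep : ∀ l, c (l + 1) - c l = vtx k (a l) - vtx k (b l)) (hab : ∀ l, a l - b l = s)
    (hs : ¬ (k : ℤ) ∣ d * s) : ¬ (system A h.pos C).HasGLP K := by
  set S := system A h.pos C with hS
  have hk0 : k ≠ 0 := by omega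
  rintro ⟨M, ℓ, hbij, hrot⟩
  have hL0 : (S.L : ℂ) ≠ 0 := by exact_mod_cast (zero_lt_one.trans S.one_lt_L).ne'
  have hL : (S.L : ℂ) ^ M ≠ 0 := zpow_ne_zero _ hL0
  have hess : ∀ x : ℤ, vtx k x - 1 ∈ S.essentialFixedPoints := fun x => by
    rw [hS, h.essentialFixedPoints_eq hk]
    exact ⟨x, rfl⟩
  have hν : ∀ i : Fin S.N, (S.L : ℂ) ^ (M + 1) * S.ν i = (S.L : ℂ) ^ M * (center i - A) := by
    intro i
    have : S.ν i = (center i - A) / (S.L : ℂ) := by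
      exact (system_ν i).trans (by simp [hS, system_L])
    rw [this, zpow_add_one₀ hL0]
    field_simp
  have hmem0 : ∀ x : ℤ, (S.L : ℂ) ^ M * (vtx k x - 1) ∈ S.allVertices M := fun x =>
    ⟨_, Set.mem_iUnion.2 ⟨0, hess x⟩, rfl⟩
  have hmem1 : ∀ c ∈ C, ∀ x : ℤ, (S.L : ℂ) ^ M * (vtx k x - 1) + (S.L : ℂ) ^ M * (c - A) ∈
      S.allVertices M := fun c hc x => by
    obtain ⟨i, rfl⟩ := exists_center_eq h.pos hc
    refine ⟨_, Set.mem_iUnion.2 ⟨1, Set.mem_iUnion.2 ⟨i, _, hess x, rfl⟩⟩, ?_⟩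
    rw [← hν, zpow_add_one₀ hL0, SimilitudeSystem.scale]
    ring
  have hinj : ∀ x y : ℤ, ℓ ⟨_, hmem0 x⟩ = ℓ ⟨_, hmem0 y⟩ → (k : ℤ) ∣ x - y := by
    intro x y hxy
    have hv : ∀ x : ℤ, (S.L : ℂ) ^ M * (vtx k x - 1) ∈ S.vertices M := fun x =>
      ⟨_, hess x, rfl⟩
    have h1 := hbij.1 (a₁ := ⟨⟨_, hmem0 x⟩, hv x⟩) (a₂ := ⟨⟨_, hmem0 y⟩, hv y⟩) hxy
    have h2 := congrArg (fun v => ((v : S.allVertices M) : ℂ)) (congrArg Subtype.val h1)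
    exact (vtx_eq_iff hk0).1 (sub_left_injective (mul_left_cancel₀ hL h2))
  -- Only the `M`-complexes inside `L ^ (M + 1) K` are needed, so the one-term sum `J = M + 1`
  -- suffices. The number `n` is the label shift of the cell.
  have hcell : ∀ c ∈ C, ∃ n : ℕ, ∀ (hc : c ∈ C) (x : ℤ),
      ℓ ⟨_, hmem1 c hc x⟩ = ℓ ⟨_, hmem0 (x + n)⟩ := by
    intro c hc
    obtain ⟨i, rfl⟩ := exists_center_eq h.pos hc
    have hcomplex : S.IsComplex K M ((S.L : ℂ) ^ M * (center i - A))
        ((fun z => z + (S.L : ℂ) ^ M * (center i - A)) '' (S.scale M '' K)) := by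
      refine ⟨⟨M + 1, le_rfl, fun _ => i, by simp [hν]⟩, rfl, ?_⟩
      rintro _ ⟨_, ⟨x, hx, rfl⟩, rfl⟩
      refine h.scale_image_subset_unboundedFractal hK (M + 1) ⟨S.Ψ i x, ?_, ?_⟩
      · rw [hK.2.2]
        exact Set.mem_iUnion.2 ⟨i, x, hx, rfl⟩
      · rw [← hν, ← hS, SimilitudeSystem.scale, SimilitudeSystem.scale, SimilitudeSystem.Ψ,
          mul_add, zpow_add_one₀ hL0]
        field_simp
    obtain ⟨n, -, hn⟩ := hrot _ _ hcomplex
    refine ⟨n, fun hc x => hn _ _ ⟨_, ⟨_, hess x, rfl⟩, rfl⟩ ?_⟩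
    rw [add_sub_cancel_right, h.rotation_eq hk]
  choose! n hn using hcell
  -- The shared vertex has index `a l` in the cell `c l` and `b l` in the next one; comparing its
  -- label in both gives the increment `s`.
  have hnext : ∀ l, (k : ℤ) ∣ s + n (c l) - n (c (l + 1)) := by
    intro l
    have hpt : (S.L : ℂ) ^ M * (vtx k (a l) - 1) + (S.L : ℂ) ^ M * (c l - A) =
        (S.L : ℂ) ^ M * (vtx k (b l) - 1) + (S.L : ℂ) ^ M * (c (l + 1) - A) := by
      linear_combination -(S.L : ℂ) ^ M * hstep l
    have h1 := hn _ (hc l) (hc l) (a l)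
    have h2 := hn _ (hc (l + 1)) (hc (l + 1)) (b l)
    have h3 : ℓ ⟨_, hmem1 (c l) (hc l) (a l)⟩ = ℓ ⟨_, hmem1 (c (l + 1)) (hc (l + 1)) (b l)⟩ :=
      congrArg ℓ (Subtype.ext hpt)
    have h4 := hinj _ _ (h1.symm.trans (h3.trans h2))
    rw [← hab l]
    rwa [show a l - b l + n (c l) - n (c (l + 1)) = a l + n (c l) - (b l + n (c (l + 1))) by ring]
  have hsum : ∀ l : ℕ, (k : ℤ) ∣ l * s + n (c 0) - n (c l) := by
    intro l
    induction l with
    | zero => simp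
    | succ l ih =>
      have := dvd_add ih (hnext l)
      rwa [show (l * s + n (c 0) - n (c l) + (s + n (c l) - n (c (l + 1))) : ℤ) =
        (l + 1 : ℕ) * s + n (c 0) - n (c (l + 1)) by push_cast; ring] at this
  apply hs
  have := hsum d
  rwa [hclosed, add_sub_cancel_right] at this

end IsConfiguration

end PolygonFractal

/-! ### Chambers of the dihedral group and separation of orbits. -/

namespace PolygonFractal

open Complex

variable {k : ℕ}

/-- Up to a sign, the signed distance to the line through the origin with the angle `π / k`. -/
noncomputable def wall (k : ℕ) (p : ℂ) : ℝ :=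
  p.re * Real.sin (Real.pi / k) - p.im * Real.cos (Real.pi / k)

/-- The orbit of a set under the symmetry group of the regular `k`-gon. -/
def orbit (k : ℕ) (Q : Set ℂ) : Set ℂ :=
  {x | ∃ p ∈ Q, ∃ j : ℤ, x = vtx k j * p ∨ x = vtx k j * (starRingEnd ℂ) p}

theorem sin_pi_div_pos (hk : 2 ≤ k) : 0 < Real.sin (Real.pi / k) := by
  have hk' : (2 : ℝ) ≤ k := by exact_mod_cast hk
  have := Real.pi_pos
  refine Real.sin_pos_of_pos_of_lt_pi (by positivity) ?_
  rw [div_lt_iff₀ (by linarith)]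
  nlinarith

theorem half_vtx_re : (vtx (2 * k) 1).re = Real.cos (Real.pi / k) := by
  rw [vtx_re]
  congr 1
  push_cast
  rw [mul_one, mul_div_mul_left _ _ two_ne_zero]

theorem half_vtx_im : (vtx (2 * k) 1).im = Real.sin (Real.pi / k) := by
  rw [vtx_im]
  congr 1
  push_cast
  rw [mul_one, mul_div_mul_left _ _ two_ne_zero]

/-- Coordinates along the two walls of the chamber; both are nonnegative exactly on the chamber. -/
theorem eq_add_mul_half_vtx (hk : 2 ≤ k) (p : ℂ) :
    p = (wall k p / Real.sin (Real.pi / k) : ℝ) +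
      (p.im / Real.sin (Real.pi / k) : ℝ) * vtx (2 * k) 1 := by
  have hs := (sin_pi_div_pos hk).ne'
  apply Complex.ext
  · simp only [add_re, ofReal_re, mul_re, ofReal_im, zero_mul, sub_zero, half_vtx_re, wall]
    field_simp
    ring
  · simp only [add_im, ofReal_re, mul_im, ofReal_im, zero_mul, add_zero, zero_add, half_vtx_im]
    field_simp

theorem re_mul_vtx_mul (s t s' t' : ℝ) (n : ℤ) :
    ((starRingEnd ℂ) (s + t * vtx (2 * k) 1) * (vtx (2 * k) n * (s' + t' * vtx (2 * k) 1))).re =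
      s * s' * (vtx (2 * k) n).re + s * t' * (vtx (2 * k) (n + 1)).re +
      t * s' * (vtx (2 * k) (n - 1)).re + t * t' * (vtx (2 * k) n).re := by
  have h1 : (starRingEnd ℂ) (s + t * vtx (2 * k) 1) *
      (vtx (2 * k) n * (s' + t' * vtx (2 * k) 1)) =
      (s * s' : ℝ) * vtx (2 * k) n + (s * t' : ℝ) * vtx (2 * k) (n + 1) +
      (t * s' : ℝ) * vtx (2 * k) (n - 1) + (t * t' : ℝ) * vtx (2 * k) n := by
    have := vtx_ne_zero (k := 2 * k) 1
    simp only [map_add, map_mul, conj_ofReal, conj_vtx, sub_eq_add_neg n, vtx_add n, vtx_neg]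
    push_cast
    field_simp
    ring
  rw [h1]
  simp

theorem re_mul_vtx_mul_conj (s t s' t' : ℝ) (n : ℤ) :
    ((starRingEnd ℂ) (s + t * vtx (2 * k) 1) *
      (vtx (2 * k) n * (starRingEnd ℂ) (s' + t' * vtx (2 * k) 1))).re =
      s * s' * (vtx (2 * k) n).re + (s * t' + t * s') * (vtx (2 * k) (n - 1)).re +
      t * t' * (vtx (2 * k) (n - 2)).re := by
  have h1 : (starRingEnd ℂ) (s + t * vtx (2 * k) 1) *
      (vtx (2 * k) n * (starRingEnd ℂ) (s' + t' * vtx (2 * k) 1)) =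
      (s * s' : ℝ) * vtx (2 * k) n + (s * t' + t * s' : ℝ) * vtx (2 * k) (n - 1) +
      (t * t' : ℝ) * vtx (2 * k) (n - 2) := by
    have := vtx_ne_zero (k := 2 * k) 1
    have e2 : vtx (2 * k) (-2) = vtx (2 * k) (-1) * vtx (2 * k) (-1) := by rw [← vtx_add]; rfl
    simp only [map_add, map_mul, conj_ofReal, conj_vtx, sub_eq_add_neg n, vtx_add n, e2]
    push_cast
    ring
  rw [h1]
  simp

theorem vtx_re_le {K : ℕ} {n : ℤ} (h : ¬ (K : ℤ) ∣ n) : (vtx K n).re ≤ (vtx K 1).re := by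
  rw [vtx_re, vtx_re]
  simpa using cos_two_pi_mul_div_le h

theorem vtx_re_neg {K : ℕ} (n : ℤ) : (vtx K (-n)).re = (vtx K n).re := by
  rw [← conj_vtx, conj_re]

theorem vtx_re_le_one {K : ℕ} (n : ℤ) : (vtx K n).re ≤ 1 := by
  rw [vtx_re]
  exact Real.cos_le_one _

theorem vtx_odd_re_le {n : ℤ} (hn : Odd n) : (vtx (2 * k) n).re ≤ (vtx (2 * k) 1).re := by
  apply vtx_re_le
  rintro ⟨c, rfl⟩
  rw [← Int.not_even_iff_odd] at hn
  exact hn ⟨k * c, by push_cast; ring⟩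

theorem vtx_even_re_le {j : ℤ} (h : ¬ (k : ℤ) ∣ j) :
    (vtx (2 * k) (2 * j)).re ≤ (vtx (2 * k) 2).re := by
  rw [vtx_two_mul, show (2 : ℤ) = 2 * 1 by rfl, vtx_two_mul]
  exact vtx_re_le h

/-- The scalar product of `p` with a point of the orbit of `p'` outside the three chambers around
`p` is at most the scalar products of `p` with the mirror images of `p'` in the two walls. -/
theorem re_conj_mul_le (hk : 2 ≤ k) {p p' x : ℂ} (h0 : 0 ≤ p.im) (h1 : 0 ≤ wall k p)
    (h0' : 0 ≤ p'.im) (h1' : 0 ≤ wall k p')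
    (hx : (∃ j : ℤ, ¬ (k : ℤ) ∣ j ∧ x = vtx k j * p') ∨
      ∃ j : ℤ, ¬ (k : ℤ) ∣ j ∧ ¬ (k : ℤ) ∣ j - 1 ∧ x = vtx k j * (starRingEnd ℂ) p') :
    ((starRingEnd ℂ) p * x).re ≤ ((starRingEnd ℂ) p * (starRingEnd ℂ) p').re ∧
    ((starRingEnd ℂ) p * x).re ≤ ((starRingEnd ℂ) p * (root k * (starRingEnd ℂ) p')).re := by
  have hs := sin_pi_div_pos hk
  obtain ⟨s, t, hs0, ht0, hp⟩ : ∃ s t : ℝ, 0 ≤ s ∧ 0 ≤ t ∧ p = s + t * vtx (2 * k) 1 :=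
    ⟨_, _, by positivity, by positivity, eq_add_mul_half_vtx hk p⟩
  obtain ⟨s', t', hs0', ht0', hp'⟩ : ∃ s t : ℝ, 0 ≤ s ∧ 0 ≤ t ∧ p' = s + t * vtx (2 * k) 1 :=
    ⟨_, _, by positivity, by positivity, eq_add_mul_half_vtx hk p'⟩
  have e1 : root k = vtx (2 * k) 2 := by rw [← vtx_one, ← vtx_two_mul]; rfl
  have cm1 := vtx_re_neg (K := 2 * k) 1
  have cm2 := vtx_re_neg (K := 2 * k) 2
  have hss := mul_nonneg hs0 hs0'
  have hst := mul_nonneg hs0 ht0'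
  have hts := mul_nonneg ht0 hs0'
  have htt := mul_nonneg ht0 ht0'
  have f0 := re_mul_vtx_mul_conj (k := k) s t s' t' 0
  have f2 := re_mul_vtx_mul_conj (k := k) s t s' t' 2
  rw [← hp, ← hp'] at f0 f2
  simp only [zero_sub, sub_self, cm1, cm2, show (2 : ℤ) - 1 = 1 from rfl, vtx_zero, one_re,
    one_mul, mul_one] at f0 f2
  rw [e1, f0, f2, hp]
  -- Termwise comparison with nonnegative coefficients: the mixed terms carry cosines of odd
  -- multiples of `π / k`, at most `cos (π / k)`; of the two pure terms one is bounded by `1` and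
  -- the other by `cos (2π / k)`.
  rcases hx with ⟨j, hj, rfl⟩ | ⟨j, hj, hj1, rfl⟩
  · rw [← vtx_two_mul j, hp', re_mul_vtx_mul]
    have a1 := vtx_even_re_le hj
    have a2 := vtx_re_le_one (K := 2 * k) (2 * j)
    have a3 := vtx_odd_re_le (k := k) (n := 2 * j + 1) ⟨j, rfl⟩
    have a4 := vtx_odd_re_le (k := k) (n := 2 * j - 1) ⟨j - 1, by ring⟩
    have b2 := mul_le_mul_of_nonneg_left a3 hst
    have b3 := mul_le_mul_of_nonneg_left a4 hts
    constructor
    · have b1 := mul_le_mul_of_nonneg_left a2 hss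
      have b4 := mul_le_mul_of_nonneg_left a1 htt
      linarith
    · have b1 := mul_le_mul_of_nonneg_left a1 hss
      have b4 := mul_le_mul_of_nonneg_left a2 htt
      linarith
  · rw [← vtx_two_mul j, hp', re_mul_vtx_mul_conj]
    have a1 := vtx_even_re_le hj
    have a2 := vtx_re_le_one (K := 2 * k) (2 * j)
    have a3 := vtx_odd_re_le (k := k) (n := 2 * j - 1) ⟨j - 1, by ring⟩
    have a5 := vtx_even_re_le hj1
    have a6 := vtx_re_le_one (K := 2 * k) (2 * (j - 1))
    rw [show 2 * (j - 1) = 2 * j - 2 by ring] at a5 a6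
    have b2 := mul_le_mul_of_nonneg_left a3 (add_nonneg hst hts)
    constructor
    · have b1 := mul_le_mul_of_nonneg_left a2 hss
      have b4 := mul_le_mul_of_nonneg_left a5 htt
      linarith
    · have b1 := mul_le_mul_of_nonneg_left a1 hss
      have b4 := mul_le_mul_of_nonneg_left a6 htt
      linarith

theorem norm_sub_sq_eq (p x : ℂ) :
    ‖p - x‖ ^ 2 = ‖p‖ ^ 2 + ‖x‖ ^ 2 - 2 * ((starRingEnd ℂ) p * x).re := by
  simp only [← normSq_eq_norm_sq, normSq_apply, sub_re, sub_im, mul_re, conj_re, conj_im]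
  ring

theorem norm_sub_conj_sq (p p' : ℂ) :
    ‖p - (starRingEnd ℂ) p'‖ ^ 2 = ‖p - p'‖ ^ 2 + 4 * (p.im * p'.im) := by
  simp only [← normSq_eq_norm_sq, normSq_apply, sub_re, sub_im, conj_re, conj_im]
  ring

theorem root_re_im : (root k).re = Real.cos (Real.pi / k) ^ 2 - Real.sin (Real.pi / k) ^ 2 ∧
    (root k).im = 2 * Real.sin (Real.pi / k) * Real.cos (Real.pi / k) := by
  have h : root k = vtx (2 * k) 1 * vtx (2 * k) 1 := by
    rw [← vtx_one, ← vtx_two_mul, ← vtx_add]; rfl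
  rw [h, mul_re, mul_im, half_vtx_re, half_vtx_im]
  constructor <;> ring

theorem norm_sub_root_mul_conj_sq (p p' : ℂ) :
    ‖p - root k * (starRingEnd ℂ) p'‖ ^ 2 = ‖p - p'‖ ^ 2 + 4 * (wall k p * wall k p') := by
  obtain ⟨h1, h2⟩ := root_re_im (k := k)
  have h3 : ‖root k * (starRingEnd ℂ) p'‖ = ‖p'‖ := by
    rw [norm_mul, norm_conj, ← vtx_one, norm_vtx, one_mul]
  rw [norm_sub_sq_eq, h3, norm_sub_sq_eq p p']
  simp only [mul_re, mul_im, conj_re, conj_im, h1, h2, wall]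
  have := Real.sin_sq_add_cos_sq (Real.pi / k)
  linear_combination -2 * (p.re * p'.re + p.im * p'.im) * this

theorem root_mul_conj_eq_self {p : ℂ} (h : wall k p = 0) : root k * (starRingEnd ℂ) p = p := by
  have := norm_sub_root_mul_conj_sq (k := k) p p
  rw [h] at this
  simp only [sub_self, norm_zero, mul_zero, ne_eq, OfNat.ofNat_ne_zero, not_false_eq_true,
    zero_pow, add_zero, pow_eq_zero_iff, norm_eq_zero, sub_eq_zero] at this
  exact this.symm

/-- If `p` or `p'` is on the mirror, `τ` fixes it and the claim reduces to `hsep`. Otherwise `4 * D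
p * D p'` exceeds `w ^ 2`, which settles even `p = p'`. Stated abstractly to serve both walls. -/
theorem separated_mirror {w : ℝ} {τ : ℂ → ℂ} {D : ℂ → ℝ} {step : ℂ → Prop} {Q : Set ℂ}
    (hw : 0 ≤ w) (hD : ∀ p p', ‖p - τ p'‖ ^ 2 = ‖p - p'‖ ^ 2 + 4 * (D p * D p'))
    (hfix : ∀ p, D p = 0 → τ p = p) (hnorm : ∀ p p', ‖τ p - τ p'‖ = ‖p - p'‖)
    (hstep : ∀ p p', step (p - p') → step (τ p - τ p'))
    (hstep_norm : ∀ z, step z → ‖z‖ = w)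
    (hQ : ∀ p ∈ Q, D p = 0 ∨ w / 2 < D p)
    (hsep : ∀ p ∈ Q, ∀ p' ∈ Q, p ≠ p' → w < ‖p - p'‖ ∨ step (p - p'))
    {p p' : ℂ} (hp : p ∈ Q) (hp' : p' ∈ Q) (hne : p ≠ τ p') :
    w < ‖p - τ p'‖ ∨ step (p - τ p') := by
  rcases hQ p hp with h0 | h0
  · have h1 := hfix p h0
    have h2 : p ≠ p' := by
      rintro rfl
      exact hne h1.symm
    rw [← h1, hnorm]
    exact (hsep p hp p' hp' h2).imp id (hstep _ _)
  rcases hQ p' hp' with h0' | h0'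
  · rw [hfix p' h0'] at hne ⊢
    exact hsep p hp p' hp' hne
  left
  refine lt_of_pow_lt_pow_left₀ 2 (norm_nonneg _) ?_
  rw [hD]
  by_cases h2 : p = p'
  · subst h2
    simp only [sub_self, norm_zero]
    nlinarith
  · have h3 : w ≤ ‖p - p'‖ := by
      rcases hsep p hp p' hp' h2 with h | h
      · exact h.le
      · exact (hstep_norm _ h).ge
    nlinarith [mul_pos (lt_of_le_of_lt (by linarith) h0 : 0 < D p)
      (lt_of_le_of_lt (by linarith) h0' : 0 < D p')]

theorem vtx_mul_mem_orbit {Q : Set ℂ} {x : ℂ} (hx : x ∈ orbit k Q) (j : ℤ) :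
    vtx k j * x ∈ orbit k Q := by
  obtain ⟨p, hp, i, rfl | rfl⟩ := hx
  · exact ⟨p, hp, j + i, Or.inl (by rw [vtx_add, mul_assoc])⟩
  · exact ⟨p, hp, j + i, Or.inr (by rw [vtx_add, mul_assoc])⟩

theorem conj_mem_orbit {Q : Set ℂ} {x : ℂ} (hx : x ∈ orbit k Q) :
    (starRingEnd ℂ) x ∈ orbit k Q := by
  obtain ⟨p, hp, i, rfl | rfl⟩ := hx
  · exact ⟨p, hp, -i, Or.inr (by rw [map_mul, conj_vtx])⟩
  · exact ⟨p, hp, -i, Or.inl (by rw [map_mul, conj_vtx, conj_conj])⟩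

/-- Separation of a subset of a chamber passes to its orbit. -/
theorem orbit_separated (hk : 2 ≤ k) {Q : Set ℂ}
    (h0 : ∀ p ∈ Q, p.im = 0 ∨ width k / 2 < p.im)
    (h1 : ∀ p ∈ Q, wall k p = 0 ∨ width k / 2 < wall k p)
    (h01 : ∀ p ∈ Q, ∀ p' ∈ Q, p.im = 0 → wall k p' = 0 → width k < ‖p - p'‖)
    (hsep : ∀ p ∈ Q, ∀ p' ∈ Q, p ≠ p' → width k < ‖p - p'‖ ∨ IsStep k (p - p'))
    {x y : ℂ} (hx : x ∈ orbit k Q) (hy : y ∈ orbit k Q) (hxy : x ≠ y) :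
    width k < ‖x - y‖ ∨ IsStep k (x - y) := by
  have hw := width_pos hk
  have hk0 : k ≠ 0 := by omega
  have hn0 : ∀ p ∈ Q, 0 ≤ p.im := fun p hp => by rcases h0 p hp with h | h <;> linarith
  have hn1 : ∀ p ∈ Q, 0 ≤ wall k p := fun p hp => by rcases h1 p hp with h | h <;> linarith
  have hle : ∀ p ∈ Q, ∀ p' ∈ Q, p ≠ p' → width k ≤ ‖p - p'‖ := fun p hp p' hp' hne => by
    rcases hsep p hp p' hp' hne with h | h
    · exact h.le
    · exact h.1.ge
  have hmirror0 : ∀ p ∈ Q, ∀ p' ∈ Q, p ≠ (starRingEnd ℂ) p' →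
      width k < ‖p - (starRingEnd ℂ) p'‖ ∨ IsStep k (p - (starRingEnd ℂ) p') :=
    fun p hp p' hp' hne => separated_mirror hw.le norm_sub_conj_sq
      (fun p hp => conj_eq_iff_im.2 hp) (fun p p' => by rw [← map_sub, norm_conj])
      (fun p p' h => by rw [← map_sub]; exact h.conj) (fun z hz => hz.1) h0 hsep hp hp' hne
  have hmirror1 : ∀ p ∈ Q, ∀ p' ∈ Q, p ≠ root k * (starRingEnd ℂ) p' →
      width k < ‖p - root k * (starRingEnd ℂ) p'‖ ∨ IsStep k (p - root k * (starRingEnd ℂ) p') :=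
    fun p hp p' hp' hne => separated_mirror (τ := fun p => root k * (starRingEnd ℂ) p) hw.le
      norm_sub_root_mul_conj_sq (fun p hp => root_mul_conj_eq_self hp)
      (fun p p' => by rw [← mul_sub, norm_mul, ← map_sub, norm_conj, ← vtx_one, norm_vtx, one_mul])
      (fun p p' h => by rw [← mul_sub, ← map_sub, ← vtx_one]; exact h.conj.vtx_mul 1)
      (fun z hz => hz.1) h1 hsep hp hp' hne
  -- A remote image of `p'` is no nearer to `p` than either mirror image. Were it within `width k`,
  -- each wall would contain `p` or `p'`: one point on both walls, or one on each, and `h01`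
  -- excludes both.
  have hfar : ∀ p ∈ Q, ∀ p' ∈ Q, ∀ z, ‖z‖ = ‖p'‖ →
      ((∃ j : ℤ, ¬ (k : ℤ) ∣ j ∧ z = vtx k j * p') ∨
        ∃ j : ℤ, ¬ (k : ℤ) ∣ j ∧ ¬ (k : ℤ) ∣ j - 1 ∧ z = vtx k j * (starRingEnd ℂ) p') →
      width k < ‖p - z‖ := by
    intro p hp p' hp' z hz hj
    by_contra! hcon
    obtain ⟨a0, a1⟩ := re_conj_mul_le hk (hn0 p hp) (hn1 p hp) (hn0 p' hp') (hn1 p' hp') hj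
    have hsq : ‖p - z‖ ^ 2 ≤ width k ^ 2 := pow_le_pow_left₀ (norm_nonneg _) hcon 2
    have b0 : ‖p - p'‖ ^ 2 + 4 * (p.im * p'.im) ≤ width k ^ 2 := by
      rw [← norm_sub_conj_sq, norm_sub_sq_eq, norm_conj]
      rw [norm_sub_sq_eq, hz] at hsq
      linarith
    have b1 : ‖p - p'‖ ^ 2 + 4 * (wall k p * wall k p') ≤ width k ^ 2 := by
      have : ‖root k * (starRingEnd ℂ) p'‖ = ‖p'‖ := by
        rw [norm_mul, norm_conj, ← vtx_one, norm_vtx, one_mul]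
      rw [← norm_sub_root_mul_conj_sq, norm_sub_sq_eq, this]
      rw [norm_sub_sq_eq, hz] at hsq
      linarith
    have hzero : ∀ D : ℂ → ℝ, (∀ q ∈ Q, D q = 0 ∨ width k / 2 < D q) →
        ‖p - p'‖ ^ 2 + 4 * (D p * D p') ≤ width k ^ 2 → D p = 0 ∨ D p' = 0 := by
      intro D hD hb
      by_contra! hne
      have c1 := (hD p hp).resolve_left hne.1
      have c2 := (hD p' hp').resolve_left hne.2
      by_cases hpp : p = p'
      · subst hpp
        simp only [sub_self, norm_zero] at hb
        nlinarith
      · have := hle p hp p' hp' hpp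
        nlinarith [mul_pos (by linarith : 0 < D p) (by linarith : 0 < D p')]
    have hnot : ∀ q ∈ Q, q.im = 0 → wall k q ≠ 0 := fun q hq hq0 hq1 => by
      have := h01 q hq q hq hq0 hq1
      simp at this
      linarith
    have hle' : ‖p - p'‖ ≤ width k := by
      refine le_of_sq_le_sq ?_ hw.le
      nlinarith [mul_nonneg (hn0 p hp) (hn0 p' hp')]
    rcases hzero Complex.im h0 b0 with c0 | c0 <;> rcases hzero (wall k) h1 b1 with c1 | c1
    · exact hnot p hp c0 c1
    · exact (h01 p hp p' hp' c0 c1).not_ge hle'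
    · rw [norm_sub_rev] at hle'
      exact (h01 p' hp' p hp c0 c1).not_ge hle'
    · exact hnot p' hp' c0 c1
  have hbase : ∀ p ∈ Q, ∀ z ∈ orbit k Q, p ≠ z → width k < ‖p - z‖ ∨ IsStep k (p - z) := by
    rintro p hp z ⟨p', hp', j, rfl | rfl⟩ hne
    · by_cases hj : (k : ℤ) ∣ j
      · rw [(vtx_eq_one_iff hk0).2 hj, one_mul] at hne ⊢
        exact hsep p hp p' hp' hne
      · exact Or.inl (hfar p hp p' hp' _ (by rw [norm_mul, norm_vtx, one_mul])
          (Or.inl ⟨j, hj, rfl⟩))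
    · by_cases hj : (k : ℤ) ∣ j
      · rw [(vtx_eq_one_iff hk0).2 hj, one_mul] at hne ⊢
        exact hmirror0 p hp p' hp' hne
      · by_cases hj1 : (k : ℤ) ∣ j - 1
        · rw [← vtx_eq_iff hk0, vtx_one] at hj1
          rw [hj1] at hne ⊢
          exact hmirror1 p hp p' hp' hne
        · exact Or.inl (hfar p hp p' hp' _ (by rw [norm_mul, norm_vtx, one_mul, norm_conj])
            (Or.inr ⟨j, hj, hj1, rfl⟩))
  -- A symmetry moves the first point into `Q` and preserves distances and steps.
  obtain ⟨p, hp, j, rfl | rfl⟩ := hx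
  · have e : vtx k j * p - y = vtx k j * (p - vtx k (-j) * y) := by
      rw [mul_sub, ← mul_assoc, ← vtx_add]; simp
    rw [e, norm_mul, norm_vtx, one_mul]
    refine (hbase p hp _ (vtx_mul_mem_orbit hy (-j)) ?_).imp id fun h => h.vtx_mul j
    intro h
    rw [← h, sub_self, mul_zero, sub_eq_zero] at e
    exact hxy e
  · have e : vtx k j * (starRingEnd ℂ) p - y =
        vtx k j * (starRingEnd ℂ) (p - vtx k j * (starRingEnd ℂ) y) := by
      rw [map_sub, mul_sub, map_mul, conj_conj, conj_vtx, ← mul_assoc _ _ y, ← vtx_add]; simp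
    rw [e, norm_mul, norm_vtx, one_mul, norm_conj]
    refine (hbase p hp _ (vtx_mul_mem_orbit (conj_mem_orbit hy) j) ?_).imp id
      fun h => h.conj.vtx_mul j
    intro h
    rw [← h, sub_self, map_zero, mul_zero, sub_eq_zero] at e
    exact hxy e

end PolygonFractal

/-! ### The planar model: segment, stem and ring, with steps of length 1. -/

namespace PolygonFractal

open Complex

variable {k : ℕ}

/-- The vertices of a regular `d`-gon with sides of length `1`, one of which is `[0, 1]`. -/
noncomputable def ringPoint (d : ℕ) (i : ℤ) : ℂ := (vtx d i - 1) / (vtx d 1 - 1)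

/-- A unit step in one of the directions of the vertices of the regular `k`-gon or opposite to
it. -/
def IsUnitStep (k : ℕ) (z : ℂ) : Prop := ∃ j : ℤ, z = vtx k j ∨ z = -vtx k j

/-- A segment of `2 n + 1` integers with a regular `d`-gon on a stem attached to its middle. -/
def model (k d n : ℕ) : Set ℂ :=
  {z | (∃ j : ℕ, j ≤ 2 * n ∧ z = j) ∨ z = n + vtx k (k / 4 : ℕ) ∨
    ∃ i : ℤ, z = n + (2 * vtx k (k / 4 : ℕ) + ringPoint d i)}

theorem vtx_sub_one_ne_zero {d : ℕ} (hd : 2 ≤ d) : vtx d 1 - 1 ≠ 0 := by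
  rw [Ne, sub_eq_zero, vtx_eq_one_iff (by omega)]
  intro h
  have := Int.le_of_dvd one_pos h
  omega

theorem ringPoint_zero (d : ℕ) : ringPoint d 0 = 0 := by simp [ringPoint]

theorem ringPoint_self {d : ℕ} (hd : d ≠ 0) : ringPoint d d = 0 := by
  simp [ringPoint, (vtx_eq_one_iff hd).2 (dvd_refl (d : ℤ))]

theorem ringPoint_succ_sub {d : ℕ} (hd : 2 ≤ d) (i : ℤ) :
    ringPoint d (i + 1) - ringPoint d i = vtx d i := by
  have := vtx_sub_one_ne_zero hd
  rw [ringPoint, ringPoint, vtx_add, ← sub_div, div_eq_iff this]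
  ring

theorem exists_nat_ringPoint_eq {d : ℕ} (hd : d ≠ 0) (i : ℤ) :
    ∃ n < d, ringPoint d (n : ℕ) = ringPoint d i := by
  obtain ⟨n, hn, h⟩ := exists_nat_vtx_eq hd i
  exact ⟨n, hn, by rw [ringPoint, ringPoint, h]⟩

theorem vtx_two_mul_eq {d : ℕ} (i : ℤ) :
    vtx (2 * d) i = exp ((Real.pi * i / d : ℝ) * I) := by
  rw [vtx_eq_exp]
  congr 3
  push_cast
  rw [mul_assoc, mul_div_mul_left _ _ two_ne_zero]

theorem vtx_sub_one_eq {d : ℕ} (i : ℤ) :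
    vtx d i - 1 = 2 * I * (Real.sin (Real.pi * i / d) : ℝ) * vtx (2 * d) i := by
  have h1 : vtx d i = vtx (2 * d) i * vtx (2 * d) i := by
    rw [← vtx_add, ← two_mul, vtx_two_mul]
  have h2 : 2 * I * (Real.sin (Real.pi * i / d) : ℝ) = vtx (2 * d) i - vtx (2 * d) (-i) := by
    have hs : (vtx (2 * d) i).im = Real.sin (Real.pi * i / d) := by
      rw [vtx_two_mul_eq, exp_ofReal_mul_I_im]
    rw [← conj_vtx, sub_conj, hs]
    push_cast
    ring
  rw [h2, sub_mul, ← h1, ← vtx_add]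
  simp

/-- Polar form seen from the vertex `0` of the `d`-gon, as in the inscribed angle theorem. -/
theorem ringPoint_eq {d : ℕ} (hd : 2 ≤ d) (i : ℤ) : ringPoint d i =
    (Real.sin (Real.pi * i / d) / Real.sin (Real.pi / d) : ℝ) * vtx (2 * d) (i - 1) := by
  have hs : ((Real.sin (Real.pi / d) : ℝ) : ℂ) ≠ 0 := by
    exact_mod_cast (sin_pi_div_pos hd).ne'
  have hv := vtx_ne_zero (k := 2 * d) 1
  rw [ringPoint, vtx_sub_one_eq, vtx_sub_one_eq, sub_eq_add_neg, vtx_add, vtx_neg]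
  push_cast at hs ⊢
  simp only [mul_one]
  have := I_ne_zero
  field_simp

theorem one_le_sin_div_sin {d i : ℕ} (hi : 1 ≤ i) (hid : i < d) :
    1 ≤ Real.sin (Real.pi * i / d) / Real.sin (Real.pi / d) := by
  have hd : 2 ≤ d := by omega
  have hs := sin_pi_div_pos hd
  have hd0 : (0 : ℝ) < d := by exact_mod_cast (by omega : 0 < d)
  have hi' : (1 : ℝ) ≤ i := by exact_mod_cast hi
  have hid' : (i : ℝ) + 1 ≤ d := by exact_mod_cast hid
  have hd2 : (2 : ℝ) ≤ d := by exact_mod_cast hd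
  have hpi := Real.pi_pos
  rw [le_div_iff₀ hs, one_mul]
  rcases le_total (2 * (i : ℝ)) d with h | h
  · refine Real.sin_le_sin_of_le_of_le_pi_div_two ?_ ?_ ?_
    · have : 0 < Real.pi / d := by positivity
      linarith
    · rw [div_le_div_iff₀ hd0 two_pos]
      nlinarith
    · refine div_le_div_of_nonneg_right ?_ hd0.le
      nlinarith
  · rw [← Real.sin_pi_sub (Real.pi * i / d),
      show Real.pi - Real.pi * i / d = Real.pi * (d - i) / d by field_simp]
    refine Real.sin_le_sin_of_le_of_le_pi_div_two ?_ ?_ ?_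
    · have : 0 < Real.pi / d := by positivity
      linarith
    · rw [div_le_div_iff₀ hd0 two_pos]
      nlinarith
    · refine div_le_div_of_nonneg_right ?_ hd0.le
      nlinarith

theorem norm_ringPoint_le {d : ℕ} (hd : 2 ≤ d) (i : ℤ) : ‖ringPoint d i‖ ≤ d := by
  have hs := sin_pi_div_pos hd
  have hd0 : (0 : ℝ) < d := by exact_mod_cast (by omega : 0 < d)
  have hd2 : (2 : ℝ) ≤ d := by exact_mod_cast hd
  have hpi := Real.pi_pos
  rw [ringPoint_eq hd, norm_mul, norm_vtx, mul_one, norm_real, Real.norm_eq_abs, abs_div,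
    abs_of_pos hs, div_le_iff₀ hs]
  have h1 : 2 / Real.pi * (Real.pi / d) ≤ Real.sin (Real.pi / d) :=
    Real.mul_le_sin (by positivity) (div_le_div_of_nonneg_left hpi.le two_pos hd2)
  have h2 : 2 / Real.pi * (Real.pi / d) = 2 / d := by field_simp
  have h3 : (d : ℝ) * (2 / d) = 2 := by field_simp
  have h4 := mul_le_mul_of_nonneg_left (h2 ▸ h1) hd0.le
  linarith [Real.abs_sin_le_one (Real.pi * i / d)]

theorem IsUnitStep.neg {z : ℂ} (h : IsUnitStep k z) : IsUnitStep k (-z) := by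
  obtain ⟨j, rfl | rfl⟩ := h
  · exact ⟨j, Or.inr rfl⟩
  · exact ⟨j, Or.inl (neg_neg _)⟩

/-- A chord of the `d`-gon is longer than its side unless the vertices are adjacent, and sides are
unit steps because `d ∣ k`. -/
theorem isUnitStep_ringPoint_sub {d e : ℕ} (hk : k ≠ 0) (hd : 2 ≤ d) (hde : k = d * e) {i j : ℤ}
    (hne : ringPoint d i ≠ ringPoint d j) :
    1 < ‖ringPoint d i - ringPoint d j‖ ∨ IsUnitStep k (ringPoint d i - ringPoint d j) := by
  have hd0 : d ≠ 0 := by omega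
  have hn := vtx_sub_one_ne_zero hd
  have hij : ¬ (d : ℤ) ∣ i - j := fun h => hne (by
    rw [ringPoint, ringPoint, (vtx_eq_iff hd0).2 h])
  have e1 : ringPoint d i - ringPoint d j =
      vtx d j * ((vtx d (i - j) - 1) / (vtx d 1 - 1)) := by
    rw [ringPoint, ringPoint, ← sub_div, mul_div_assoc', mul_sub, ← vtx_add]
    simp
  have hstep : ∀ m : ℤ, IsUnitStep k (vtx d m) ∧ IsUnitStep k (-vtx d m) := fun m => by
    rw [vtx_mul hk hde]
    exact ⟨⟨_, Or.inl rfl⟩, ⟨_, Or.inr rfl⟩⟩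
  have hre := vtx_re_le hij
  rcases hre.lt_or_eq with hlt | heq
  · left
    rw [e1, norm_mul, norm_vtx, one_mul, norm_div, one_lt_div (norm_pos_iff.2 hn)]
    refine lt_of_pow_lt_pow_left₀ 2 (norm_nonneg _) ?_
    have h1 := norm_vtx_sub_sq (k := d) 1 0
    have h2 := norm_vtx_sub_sq (k := d) (i - j) 0
    rw [vtx_zero, sub_zero] at h1 h2
    rw [h1, h2]
    rw [vtx_re, vtx_re] at hlt
    linarith
  · right
    have him : (vtx d (i - j)).im ^ 2 = (vtx d 1).im ^ 2 := by
      have h1 : ∀ m : ℤ, (vtx d m).re ^ 2 + (vtx d m).im ^ 2 = 1 := fun m => by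
        rw [vtx_re, vtx_im]
        linarith [Real.sin_sq_add_cos_sq (2 * Real.pi * m / d)]
      have h2 := h1 (i - j)
      have h3 := h1 1
      rw [heq] at h2
      linarith
    rcases sq_eq_sq_iff_eq_or_eq_neg.1 him with h | h
    · have h4 : vtx d (i - j) = vtx d 1 := Complex.ext heq h
      rw [e1, h4, div_self hn, mul_one]
      exact (hstep j).1
    · have h4 : vtx d (i - j) = vtx d (-1) := by
        rw [← conj_vtx]
        exact Complex.ext (by rw [conj_re, heq]) (by rw [conj_im, h])
      have h5 : (vtx d (-1) - 1) / (vtx d 1 - 1) = -vtx d (-1) := by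
        rw [div_eq_iff hn, neg_mul, mul_sub, ← vtx_add]
        simp
      rw [e1, h4, h5, mul_neg, ← vtx_add]
      exact (hstep _).2

/-- The direction of the stem makes an angle between `π / 3` and `π / 2` with the segment. -/
theorem stem_angle (hk : k = 6 ∨ 9 ≤ k) :
    Real.pi / 3 ≤ 2 * Real.pi * (k / 4 : ℕ) / k ∧ 2 * Real.pi * (k / 4 : ℕ) / k ≤ Real.pi / 2 := by
  have hk0 : (0 : ℝ) < k := by exact_mod_cast (by omega : 0 < k)
  have h1 : (4 * (k / 4 : ℕ) : ℝ) ≤ k := by exact_mod_cast (by omega : 4 * (k / 4) ≤ k)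
  have h2 : (k : ℝ) ≤ 6 * (k / 4 : ℕ) := by exact_mod_cast (by omega : k ≤ 6 * (k / 4))
  have := Real.pi_pos
  constructor
  · rw [div_le_div_iff₀ three_pos hk0]
    nlinarith
  · rw [div_le_div_iff₀ hk0 two_pos]
    nlinarith

theorem stem_re_im (hk : k = 6 ∨ 9 ≤ k) : 0 ≤ (vtx k (k / 4 : ℕ)).re ∧
    (vtx k (k / 4 : ℕ)).re ≤ 1 / 2 ∧ 1 / 2 < (vtx k (k / 4 : ℕ)).im := by
  obtain ⟨h1, h2⟩ := stem_angle hk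
  have hpi := Real.pi_pos
  rw [vtx_re, vtx_im]
  simp only [Int.cast_natCast]
  refine ⟨Real.cos_nonneg_of_neg_pi_div_two_le_of_le (by linarith) h2, ?_, ?_⟩
  · rw [← Real.cos_pi_div_three]
    exact Real.cos_le_cos_of_nonneg_of_le_pi (by linarith) (by linarith) h1
  · rw [← Real.sin_pi_div_six]
    exact Real.sin_lt_sin_of_lt_of_le_pi_div_two (by linarith) h2 (by linarith)

/-- The only delicate case is `n = 1` with the stem at angle exactly `π / 3`: the triangle is then
equilateral, and the difference is the conjugate vertex. -/
theorem isUnitStep_intCast_sub_stem (hk : k = 6 ∨ 9 ≤ k) (n : ℤ) :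
    1 < ‖(n : ℂ) - vtx k (k / 4 : ℕ)‖ ∨ IsUnitStep k (n - vtx k (k / 4 : ℕ)) := by
  obtain ⟨h1, h2, h3⟩ := stem_re_im hk
  set v := vtx k (k / 4 : ℕ) with hv
  have hsq : v.re ^ 2 + v.im ^ 2 = 1 := by
    rw [hv, vtx_re, vtx_im]
    linarith [Real.sin_sq_add_cos_sq (2 * Real.pi * ((k / 4 : ℕ) : ℤ) / k)]
  have hnorm : ‖(n : ℂ) - v‖ ^ 2 = n ^ 2 - 2 * n * v.re + 1 := by
    rw [← normSq_eq_norm_sq, normSq_apply]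
    simp only [sub_re, sub_im, intCast_re, intCast_im]
    linear_combination hsq
  have hlt : 1 < (n : ℝ) ^ 2 - 2 * n * v.re + 1 → 1 < ‖(n : ℂ) - v‖ := fun h => by
    refine lt_of_pow_lt_pow_left₀ 2 (norm_nonneg _) ?_
    rw [hnorm]
    simpa using h
  rcases lt_trichotomy n 0 with hn | rfl | hn
  · left
    apply hlt
    have : (n : ℝ) ≤ -1 := by exact_mod_cast (by omega : n ≤ -1)
    nlinarith
  · exact Or.inr ⟨(k / 4 : ℕ), Or.inr (by simp [hv])⟩
  · rcases (by omega : n = 1 ∨ 2 ≤ n) with rfl | hn2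
    · rcases h2.lt_or_eq with hlt2 | heq
      · left
        apply hlt
        push_cast
        linarith
      · refine Or.inr ⟨-(k / 4 : ℕ), Or.inl ?_⟩
        rw [← conj_vtx, ← hv]
        apply Complex.ext
        · simp [heq]; norm_num
        · simp
    · left
      apply hlt
      have : (2 : ℝ) ≤ n := by exact_mod_cast hn2
      nlinarith

/-- The nonzero ring points have arguments between `0` and `π - 2π/d`, which leaves room for a turn
by `β`. -/
theorem ringPoint_im_nonneg {d : ℕ} (hd : 3 ≤ d) (i : ℤ) {β : ℝ} (hβ : 0 ≤ β)
    (hβd : β ≤ 2 * Real.pi / d) : 0 ≤ (exp (β * I) * ringPoint d i).im := by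
  obtain ⟨n, hn, h⟩ := exists_nat_ringPoint_eq (d := d) (by omega) i
  have hd0 : (0 : ℝ) < d := by exact_mod_cast (by omega : 0 < d)
  have hpi := Real.pi_pos
  rw [← h]
  rcases Nat.eq_zero_or_pos n with rfl | hn0
  · simp [ringPoint_zero]
  · have h1 := one_le_sin_div_sin hn0 hn
    have hn1 : (1 : ℝ) ≤ n := by exact_mod_cast hn0
    have hnd : (n : ℝ) + 1 ≤ d := by exact_mod_cast hn
    rw [ringPoint_eq (by omega), mul_left_comm, vtx_two_mul_eq, ← exp_add, ← add_mul, ← ofReal_add,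
      im_ofReal_mul, exp_ofReal_mul_I_im]
    refine mul_nonneg ?_ (Real.sin_nonneg_of_nonneg_of_le_pi ?_ ?_)
    · simp only [Int.cast_natCast]
      linarith
    · push_cast
      have : 0 ≤ Real.pi * ((n : ℝ) - 1) / d := by
        refine div_nonneg (mul_nonneg hpi.le ?_) hd0.le
        linarith
      linarith
    · push_cast
      have : Real.pi * ((n : ℝ) - 1) / d ≤ Real.pi - 2 * Real.pi / d := by
        rw [div_le_iff₀ hd0, sub_mul, div_mul_cancel₀ _ hd0.ne']
        nlinarith
      linarith

/-- A nonzero ring point has modulus `r ≥ 1` and makes an angle below `2π/3` with the stem, so the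
squared norm exceeds `1 + r ^ 2 - r ≥ 1`. -/
theorem isUnitStep_stem_add_ringPoint (hk : k = 6 ∨ 9 ≤ k) {d : ℕ} (hd : 3 ≤ d) (i : ℤ) :
    1 < ‖vtx k (k / 4 : ℕ) + ringPoint d i‖ ∨
      IsUnitStep k (vtx k (k / 4 : ℕ) + ringPoint d i) := by
  obtain ⟨n, hn, h⟩ := exists_nat_ringPoint_eq (d := d) (by omega) i
  have hd0 : (0 : ℝ) < d := by exact_mod_cast (by omega : 0 < d)
  have hpi := Real.pi_pos
  rw [← h]
  rcases Nat.eq_zero_or_pos n with rfl | hn0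
  · exact Or.inr ⟨(k / 4 : ℕ), Or.inl (by simp [ringPoint_zero])⟩
  · left
    have h1 := one_le_sin_div_sin hn0 hn
    have hn1 : (1 : ℝ) ≤ n := by exact_mod_cast hn0
    have hnd : (n : ℝ) + 1 ≤ d := by exact_mod_cast hn
    obtain ⟨ha1, ha2⟩ := stem_angle hk
    rw [ringPoint_eq (by omega), vtx_two_mul_eq, vtx_eq_exp]
    simp only [Int.cast_natCast]
    set r := Real.sin (Real.pi * n / d) / Real.sin (Real.pi / d)
    set ψ := 2 * Real.pi * ((k / 4 : ℕ) : ℝ) / k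
    set γ := Real.pi * (((n : ℤ) - 1 : ℤ) : ℝ) / d with hγ
    have hγ0 : 0 ≤ γ := by
      rw [hγ]
      push_cast
      refine div_nonneg (mul_nonneg hpi.le ?_) hd0.le
      linarith
    have hγ1 : γ < Real.pi := by
      rw [hγ, div_lt_iff₀ hd0]
      push_cast
      nlinarith
    have hcos : -(1 / 2) < Real.cos (γ - ψ) := by
      have e : -(1 / 2 : ℝ) = Real.cos (2 * Real.pi / 3) := by
        rw [show 2 * Real.pi / 3 = Real.pi - Real.pi / 3 by ring, Real.cos_pi_sub,
          Real.cos_pi_div_three]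
      rw [e, ← Real.cos_abs (γ - ψ)]
      refine Real.cos_lt_cos_of_nonneg_of_le_pi (abs_nonneg _) (by linarith) ?_
      rw [abs_lt]
      constructor <;> linarith
    refine lt_of_pow_lt_pow_left₀ 2 (norm_nonneg _) ?_
    have : ‖exp ((ψ : ℝ) * I) + r * exp ((γ : ℝ) * I)‖ ^ 2 =
        1 + r ^ 2 + 2 * r * Real.cos (γ - ψ) := by
      rw [← normSq_eq_norm_sq, normSq_apply]
      simp only [add_re, add_im, re_ofReal_mul, im_ofReal_mul, exp_ofReal_mul_I_re,
        exp_ofReal_mul_I_im, Real.cos_sub]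
      linear_combination Real.sin_sq_add_cos_sq ψ + r ^ 2 * Real.sin_sq_add_cos_sq γ
    rw [this]
    nlinarith

end PolygonFractal

/-! ### Separation, position and connectedness of the model. -/

namespace PolygonFractal

open Complex

variable {k d e n : ℕ}

theorem model_separated (hk : k = 6 ∨ 9 ≤ k) (hd : 3 ≤ d) (hde : k = d * e) {z z' : ℂ}
    (hz : z ∈ model k d n) (hz' : z' ∈ model k d n) (hne : z ≠ z') :
    1 < ‖z - z'‖ ∨ IsUnitStep k (z - z') := by
  have hk0 : k ≠ 0 := by omega
  have hsymm : ∀ x y : ℂ, 1 < ‖x - y‖ ∨ IsUnitStep k (x - y) →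
      1 < ‖y - x‖ ∨ IsUnitStep k (y - x) := fun x y h => by
    rw [norm_sub_rev, ← neg_sub x y]
    exact h.imp id fun h => h.neg
  have hstem := stem_re_im hk
  have line_line : ∀ i j : ℕ, (i : ℂ) ≠ j → 1 < ‖(i : ℂ) - j‖ ∨ IsUnitStep k (i - j) := by
    intro i j hij
    have hij' : (i : ℤ) - j ≠ 0 := fun h => hij (by exact_mod_cast (by omega : i = j))
    have e1 : (i : ℂ) - j = ((i - j : ℤ) : ℂ) := by push_cast; rfl
    rw [e1, norm_intCast]
    generalize (i : ℤ) - j = m at *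
    have hm : m = 1 ∨ m = -1 ∨ 1 < |m| := by
      rw [lt_abs]
      omega
    rcases hm with rfl | rfl | h
    · exact Or.inr ⟨0, Or.inl (by simp)⟩
    · exact Or.inr ⟨0, Or.inr (by simp)⟩
    · exact Or.inl (by exact_mod_cast h)
  have line_stem : ∀ i : ℕ, 1 < ‖(i : ℂ) - (n + vtx k (k / 4 : ℕ))‖ ∨
      IsUnitStep k (i - (n + vtx k (k / 4 : ℕ))) := by
    intro i
    have e1 : (i : ℂ) - (n + vtx k (k / 4 : ℕ)) = ((i - n : ℤ) : ℂ) - vtx k (k / 4 : ℕ) := by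
      push_cast
      ring
    rw [e1]
    exact isUnitStep_intCast_sub_stem hk _
  -- A stem of two steps, each rising by more than `1 / 2`, lifts the ring above height `1`; a
  -- single step would not be enough for this bound.
  have line_ring : ∀ (i : ℕ) (j : ℤ),
      1 < ‖(i : ℂ) - (n + (2 * vtx k (k / 4 : ℕ) + ringPoint d j))‖ := by
    intro i j
    have h1 := ringPoint_im_nonneg hd j le_rfl (by positivity : (0 : ℝ) ≤ 2 * Real.pi / d)
    simp only [ofReal_zero, zero_mul, exp_zero, one_mul] at h1
    refine lt_of_lt_of_le ?_ (abs_im_le_norm _)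
    simp only [sub_im, add_im, mul_im, natCast_im, re_ofNat, im_ofNat, zero_mul, add_zero,
      zero_add, zero_sub, abs_neg]
    rw [lt_abs]
    left
    linarith [hstem.2.2]
  have ring_stem : ∀ j : ℤ, 1 < ‖((n : ℂ) + (2 * vtx k (k / 4 : ℕ) + ringPoint d j)) -
      (n + vtx k (k / 4 : ℕ))‖ ∨ IsUnitStep k (((n : ℂ) + (2 * vtx k (k / 4 : ℕ) +
        ringPoint d j)) - (n + vtx k (k / 4 : ℕ))) := by
    intro j
    have e1 : ((n : ℂ) + (2 * vtx k (k / 4 : ℕ) + ringPoint d j)) - (n + vtx k (k / 4 : ℕ)) =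
        vtx k (k / 4 : ℕ) + ringPoint d j := by ring
    rw [e1]
    exact isUnitStep_stem_add_ringPoint hk hd j
  rcases hz with ⟨i, -, rfl⟩ | rfl | ⟨i, rfl⟩ <;> rcases hz' with ⟨j, -, rfl⟩ | rfl | ⟨j, rfl⟩
  · exact line_line i j hne
  · exact line_stem i
  · exact Or.inl (line_ring i j)
  · exact hsymm _ _ (line_stem j)
  · exact absurd rfl hne
  · exact hsymm _ _ (ring_stem j)
  · exact hsymm _ _ (Or.inl (line_ring j i))
  · exact ring_stem i
  · have e1 : ((n : ℂ) + (2 * vtx k (k / 4 : ℕ) + ringPoint d i)) -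
        (n + (2 * vtx k (k / 4 : ℕ) + ringPoint d j)) = ringPoint d i - ringPoint d j := by ring
    rw [e1]
    exact isUnitStep_ringPoint_sub hk0 (by omega) hde fun h => hne (by rw [h])

theorem model_cases (hd : 2 ≤ d) {z : ℂ} (hz : z ∈ model k d n) :
    (∃ j : ℕ, j ≤ 2 * n ∧ z = j) ∨ ∃ y : ℂ, z = n + y ∧ ‖y‖ ≤ d + 2 := by
  rcases hz with h | rfl | ⟨i, rfl⟩
  · exact Or.inl h
  · refine Or.inr ⟨_, rfl, ?_⟩
    rw [norm_vtx]
    have : (0 : ℝ) ≤ d := Nat.cast_nonneg d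
    linarith
  · refine Or.inr ⟨_, rfl, ?_⟩
    refine (norm_add_le _ _).trans ?_
    rw [norm_mul, norm_vtx]
    have := norm_ringPoint_le hd i
    simp only [norm_ofNat, mul_one]
    linarith

theorem four_fifths_le_cos {β : ℝ} (h0 : 0 ≤ β) (h1 : β ≤ Real.pi / 6) : 4 / 5 ≤ Real.cos β := by
  have h2 : Real.cos (Real.pi / 6) ≤ Real.cos β :=
    Real.cos_le_cos_of_nonneg_of_le_pi h0 (by linarith [Real.pi_pos]) h1
  rw [Real.cos_pi_div_six] at h2
  have h3 : (8 / 5 : ℝ) ≤ √3 := Real.le_sqrt_of_sq_le (by norm_num)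
  linarith

theorem half_lt_re_add {β : ℝ} (h0 : 0 ≤ β) (h1 : β ≤ Real.pi / 6) (hn : 2 * d + 6 ≤ n) {y : ℂ}
    (hy : ‖y‖ ≤ d + 2) : 1 / 2 < (exp (β * I) * (n + y)).re := by
  have h2 := four_fifths_le_cos h0 h1
  have h3 : ‖exp (β * I) * y‖ ≤ d + 2 := by rwa [norm_mul, norm_exp_ofReal_mul_I, one_mul]
  have h4 := (abs_le.1 (abs_re_le_norm (exp (β * I) * y))).1
  have hn' : (2 * d + 6 : ℝ) ≤ n := by exact_mod_cast hn
  have h5 : (exp (β * I) * n).re = Real.cos β * n := by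
    rw [← ofReal_natCast, re_mul_ofReal, exp_ofReal_mul_I_re]
  have hd0 : (0 : ℝ) ≤ d := Nat.cast_nonneg d
  rw [mul_add, add_re, h5]
  nlinarith

theorem half_lt_re_natCast {β : ℝ} (h0 : 0 ≤ β) (h1 : β ≤ Real.pi / 6) {j : ℕ} (hj : 1 ≤ j) :
    1 / 2 < (exp (β * I) * j).re := by
  have h2 := four_fifths_le_cos h0 h1
  have hj' : (1 : ℝ) ≤ j := by exact_mod_cast hj
  rw [← ofReal_natCast, re_mul_ofReal, exp_ofReal_mul_I_re]
  nlinarith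

/-- After scaling by the step length `width k`, the bound `1 / 2` becomes the distance to a wall
demanded by `orbit_separated`; `model_right` serves the other wall. -/
theorem model_left {β : ℝ} (h0 : 0 ≤ β) (h1 : β ≤ Real.pi / 6) (hd : 2 ≤ d) (hn : 2 * d + 6 ≤ n)
    {z : ℂ} (hz : z ∈ model k d n) : z = 0 ∨ 1 / 2 < (exp (β * I) * z).re := by
  rcases model_cases hd hz with ⟨j, -, rfl⟩ | ⟨y, rfl, hy⟩
  · rcases Nat.eq_zero_or_pos j with rfl | hj
    · exact Or.inl Nat.cast_zero
    · exact Or.inr (half_lt_re_natCast h0 h1 hj)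
  · exact Or.inr (half_lt_re_add h0 h1 hn hy)

theorem model_right {β : ℝ} (h0 : 0 ≤ β) (h1 : β ≤ Real.pi / 6) (hd : 2 ≤ d) (hn : 2 * d + 6 ≤ n)
    {z : ℂ} (hz : z ∈ model k d n) :
    z = (2 * n : ℕ) ∨ 1 / 2 < (exp (β * I) * ((2 * n : ℕ) - z)).re := by
  rcases model_cases hd hz with ⟨j, hj, rfl⟩ | ⟨y, rfl, hy⟩
  · rcases hj.eq_or_lt with rfl | hj
    · exact Or.inl rfl
    · right
      rw [← Nat.cast_sub hj.le]
      exact half_lt_re_natCast h0 h1 (by omega)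
  · right
    have := half_lt_re_add h0 h1 hn (y := -y) (by rwa [norm_neg])
    convert this using 3
    push_cast
    ring

/-- This keeps the piece on the inner side of the edge of the large polygon: stem and ring point
towards the centre. -/
theorem model_im_nonneg (hk : k = 6 ∨ 9 ≤ k) (hd : 3 ≤ d) (hdk : d ≤ k) {β : ℝ} (h0 : 0 ≤ β)
    (h1 : β ≤ Real.pi / k) {z : ℂ} (hz : z ∈ model k d n) : 0 ≤ (exp (β * I) * z).im := by
  have hk6 : (6 : ℝ) ≤ k := by exact_mod_cast (by omega : 6 ≤ k)
  have hd0 : (0 : ℝ) < d := by exact_mod_cast (by omega : 0 < d)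
  have hdk' : (d : ℝ) ≤ k := by exact_mod_cast hdk
  have hpi := Real.pi_pos
  have hb : β ≤ Real.pi / 6 := h1.trans (div_le_div_of_nonneg_left hpi.le (by norm_num) hk6)
  have hnat : ∀ j : ℕ, 0 ≤ (exp (β * I) * j).im := fun j => by
    rw [← ofReal_natCast, im_mul_ofReal, exp_ofReal_mul_I_im]
    exact mul_nonneg (Real.sin_nonneg_of_nonneg_of_le_pi h0 (by linarith)) (Nat.cast_nonneg j)
  have hstem : 0 ≤ (exp (β * I) * vtx k (k / 4 : ℕ)).im := by
    obtain ⟨a1, a2⟩ := stem_angle hk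
    rw [vtx_eq_exp, ← exp_add, ← add_mul, ← ofReal_add, exp_ofReal_mul_I_im]
    simp only [Int.cast_natCast]
    exact Real.sin_nonneg_of_nonneg_of_le_pi (by linarith) (by linarith)
  rcases hz with ⟨j, -, rfl⟩ | rfl | ⟨i, rfl⟩
  · exact hnat j
  · rw [mul_add, add_im]
    exact add_nonneg (hnat n) hstem
  · have h2 := ringPoint_im_nonneg hd i h0 (h1.trans (by
      rw [div_le_div_iff₀ (by linarith) hd0]
      nlinarith))
    have e1 : exp (β * I) * (n + (2 * vtx k (k / 4 : ℕ) + ringPoint d i)) =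
        exp (β * I) * n + (exp (β * I) * vtx k (k / 4 : ℕ) + exp (β * I) * vtx k (k / 4 : ℕ) +
          exp (β * I) * ringPoint d i) := by ring
    rw [e1, add_im, add_im, add_im]
    exact add_nonneg (hnat n) (add_nonneg (add_nonneg hstem hstem) h2)

theorem model_finite (hd : d ≠ 0) : (model k d n).Finite := by
  have h1 : {z : ℂ | ∃ j : ℕ, j ≤ 2 * n ∧ z = j}.Finite := by
    refine ((Set.finite_Iic (2 * n)).image fun j : ℕ => (j : ℂ)).subset ?_
    rintro _ ⟨j, hj, rfl⟩
    exact ⟨j, hj, rfl⟩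
  have h2 : {z : ℂ | ∃ i : ℤ, z = n + (2 * vtx k (k / 4 : ℕ) + ringPoint d i)}.Finite := by
    refine ((Set.finite_Iio d).image fun j : ℕ =>
      (n : ℂ) + (2 * vtx k (k / 4 : ℕ) + ringPoint d j)).subset ?_
    rintro _ ⟨i, rfl⟩
    obtain ⟨j, hj, h⟩ := exists_nat_ringPoint_eq hd i
    exact ⟨j, hj, by simp only [h]⟩
  exact h1.union ((Set.finite_singleton _).union h2)

theorem model_connected (hk : k ≠ 0) (hd : 2 ≤ d) (hde : k = d * e) {z : ℂ}
    (hz : z ∈ model k d n) :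
    Relation.ReflTransGen (fun x y => y ∈ model k d n ∧ IsUnitStep k (y - x)) 0 z := by
  have hline : ∀ j : ℕ, j ≤ 2 * n →
      Relation.ReflTransGen (fun x y => y ∈ model k d n ∧ IsUnitStep k (y - x)) 0 j := by
    intro j
    induction j with
    | zero => intro _; rw [Nat.cast_zero]
    | succ j ih =>
      intro hj
      exact (ih (by omega)).tail ⟨Or.inl ⟨_, hj, rfl⟩, 0, Or.inl (by simp)⟩
  have hstem := (hline n (by omega)).tail (c := (n : ℂ) + vtx k (k / 4 : ℕ))
    ⟨Or.inr (Or.inl rfl), (k / 4 : ℕ), Or.inl (by ring)⟩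
  have hring : ∀ j : ℕ, Relation.ReflTransGen
      (fun x y => y ∈ model k d n ∧ IsUnitStep k (y - x)) 0
      ((n : ℂ) + (2 * vtx k (k / 4 : ℕ) + ringPoint d j)) := by
    intro j
    induction j with
    | zero =>
      exact hstem.tail ⟨Or.inr (Or.inr ⟨_, rfl⟩), (k / 4 : ℕ), Or.inl (by
        rw [Nat.cast_zero, ringPoint_zero]; ring)⟩
    | succ j ih =>
      refine ih.tail ⟨Or.inr (Or.inr ⟨_, rfl⟩), e * j, Or.inl ?_⟩
      rw [← vtx_mul hk hde, ← ringPoint_succ_sub hd]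
      push_cast
      ring
  rcases hz with ⟨j, hj, rfl⟩ | rfl | ⟨i, rfl⟩
  · exact hline j hj
  · exact hstem
  · obtain ⟨j, -, h⟩ := exists_nat_ringPoint_eq (d := d) (by omega) i
    rw [← h]
    exact hring j

end PolygonFractal

/-! ### From a piece of a chamber to the fractal. -/

namespace PolygonFractal

open Complex NestedFractal

variable {k d e n : ℕ}

theorem orbit_finite (hk : k ≠ 0) {Q : Set ℂ} (hQ : Q.Finite) : (orbit k Q).Finite := by
  have hfin := (Set.finite_Iio k).prod hQ
  refine ((hfin.image fun x : ℕ × ℂ => vtx k x.1 * x.2).union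
    (hfin.image fun x : ℕ × ℂ => vtx k x.1 * (starRingEnd ℂ) x.2)).subset ?_
  rintro _ ⟨p, hp, j, rfl | rfl⟩ <;> obtain ⟨m, hm, h⟩ := exists_nat_vtx_eq hk j
  · exact Or.inl ⟨(m, p), ⟨hm, hp⟩, by simp only [h]⟩
  · exact Or.inr ⟨(m, p), ⟨hm, hp⟩, by simp only [h]⟩

theorem subset_orbit (Q : Set ℂ) : Q ⊆ orbit k Q := fun p hp => ⟨p, hp, 0, Or.inl (by simp)⟩

/-- The chamber cut off by the edge is the triangle spanned by `0`, the corner and the midpoint of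
the edge; the weights are the coordinates along the walls. -/
theorem div_mem_polygon_of_chamber (hk : 3 ≤ k) {A : ℝ} (hA : 0 < A) {p : ℂ} (h0 : 0 ≤ p.im)
    (h1 : 0 ≤ wall k p)
    (h2 : p.re * Real.cos (Real.pi / k) + p.im * Real.sin (Real.pi / k) ≤
      A * Real.cos (Real.pi / k)) : p / A ∈ polygon k := by
  have hs := sin_pi_div_pos (k := k) (by omega)
  have hk' : (3 : ℝ) ≤ k := by exact_mod_cast hk
  have hpi := Real.pi_pos
  have hc : 0 < Real.cos (Real.pi / k) := by
    refine Real.cos_pos_of_mem_Ioo ⟨by linarith [div_pos hpi (by linarith : (0 : ℝ) < k)], ?_⟩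
    exact div_lt_div_of_pos_left hpi two_pos (by linarith)
  set S := Real.sin (Real.pi / k) with hS
  set c := Real.cos (Real.pi / k) with hc_def
  have hsc := Real.sin_sq_add_cos_sq (Real.pi / k)
  rw [← hS, ← hc_def] at hsc
  have hmid : (1 / 2 : ℝ) * vtx k 0 + (1 / 2 : ℝ) * vtx k 1 ∈ polygon k :=
    smul_add_smul_mem_polygon (by omega) (vtx_mem_polygon 0) (vtx_mem_polygon 1) (by norm_num)
      (by norm_num) (by norm_num)
  have hmid' : ((1 / 2 : ℝ) * vtx k 0 + (1 / 2 : ℝ) * vtx k 1 : ℂ) = c * vtx (2 * k) 1 := by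
    obtain ⟨r1, r2⟩ := root_re_im (k := k)
    rw [vtx_zero, vtx_one]
    apply Complex.ext
    · rw [re_ofReal_mul, half_vtx_re]
      simp only [add_re, re_ofReal_mul, one_re, r1]
      linear_combination (-1 / 2 : ℝ) * hsc
    · rw [im_ofReal_mul, half_vtx_im]
      simp only [add_im, im_ofReal_mul, one_im, r2]
      ring
  have h3 := smul_add_smul_mem_polygon (by omega) (vtx_mem_polygon 0) hmid
    (s := wall k p / (A * S)) (t := p.im / (A * S * c)) (by positivity) (by positivity) (by
      rw [div_add_div _ _ (by positivity) (by positivity), div_le_one (by positivity)]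
      have : wall k p * c + p.im ≤ A * S * c := by
        rw [wall, ← hS, ← hc_def]
        nlinarith
      nlinarith [mul_le_mul_of_nonneg_left this (by positivity : 0 ≤ A * S)])
  rw [hmid', vtx_zero] at h3
  convert h3 using 1
  have hA' : (A : ℂ) ≠ 0 := by exact_mod_cast hA.ne'
  have hs' : (S : ℂ) ≠ 0 := by exact_mod_cast hs.ne'
  have hc' : (c : ℂ) ≠ 0 := by exact_mod_cast hc.ne'
  have e := eq_add_mul_half_vtx (k := k) (by omega) p
  rw [← hS] at e
  conv_lhs => rw [e]
  push_cast
  field_simp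

/-- A piece of a chamber, made up of steps, that joins the two walls of the chamber, generates a
configuration. -/
theorem isConfiguration_orbit (hk : 3 ≤ k) {A : ℝ} (hA : 0 < A) {Q : Set ℂ} (hQ : Q.Finite)
    (hAQ : (A : ℂ) ∈ Q) {B : ℂ} (hBQ : B ∈ Q) (hB : wall k B = 0)
    (h0 : ∀ p ∈ Q, p.im = 0 ∨ width k / 2 < p.im)
    (h1 : ∀ p ∈ Q, wall k p = 0 ∨ width k / 2 < wall k p)
    (h01 : ∀ p ∈ Q, ∀ p' ∈ Q, p.im = 0 → wall k p' = 0 → width k < ‖p - p'‖)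
    (hsep : ∀ p ∈ Q, ∀ p' ∈ Q, p ≠ p' → width k < ‖p - p'‖ ∨ IsStep k (p - p'))
    (hside : ∀ p ∈ Q, p.re * Real.cos (Real.pi / k) + p.im * Real.sin (Real.pi / k) ≤
      A * Real.cos (Real.pi / k))
    (hconn : ∀ p ∈ Q, Relation.ReflTransGen (fun x y => y ∈ Q ∧ IsStep k (y - x)) (A : ℂ) p) :
    IsConfiguration k A (orbit_finite (by omega) hQ : (orbit k Q).Finite).toFinset := by
  have hk0 : k ≠ 0 := by omega
  have hw := width_pos (k := k) (by omega)
  have hA' : (A : ℂ) ≠ 0 := by exact_mod_cast hA.ne'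
  set R : ℂ → ℂ → Prop := fun x y => x ∈ orbit k Q ∧ y ∈ orbit k Q ∧ IsStep k (y - x) with hR
  have hsymm : Std.Symm R :=
    ⟨fun x y h => ⟨h.2.1, h.1, by rw [← neg_sub]; exact h.2.2.neg⟩⟩
  have hmul : ∀ (j : ℤ) {x y : ℂ}, Relation.ReflTransGen R x y →
      Relation.ReflTransGen R (vtx k j * x) (vtx k j * y) := fun j x y h =>
    h.lift (fun x => vtx k j * x) fun x y hxy => ⟨vtx_mul_mem_orbit hxy.1 j,
      vtx_mul_mem_orbit hxy.2.1 j, by rw [← mul_sub]; exact hxy.2.2.vtx_mul j⟩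
  have hconj : ∀ {x y : ℂ}, Relation.ReflTransGen R x y →
      Relation.ReflTransGen R ((starRingEnd ℂ) x) ((starRingEnd ℂ) y) := fun {x y} h =>
    h.lift (starRingEnd ℂ) fun x y hxy => ⟨conj_mem_orbit hxy.1,
      conj_mem_orbit hxy.2.1, by rw [← map_sub]; exact hxy.2.2.conj⟩
  have hRQ : ∀ p ∈ Q, Relation.ReflTransGen R A p := fun p hp => by
    induction hconn p hp with
    | refl => exact Relation.ReflTransGen.refl
    | @tail b c hb hbc ih =>
      have hbQ : b ∈ Q := by
        rcases (Relation.ReflTransGen.cases_tail_iff _ _ _).1 hb with h | ⟨_, -, h, -⟩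
        · exact h ▸ hAQ
        · exact h
      exact (ih hbQ).tail ⟨subset_orbit Q hbQ, subset_orbit Q hbc.1, hbc.2⟩
  -- `B` lies on the wall and is fixed by the reflection in it, so the chain from `A` to `B`
  -- continues with its mirror image to the next corner.
  have hroot : Relation.ReflTransGen R A (vtx k 1 * A) := by
    have h2 := hRQ B hBQ
    have h3 := hmul 1 (hconj h2)
    rw [vtx_one, root_mul_conj_eq_self hB, conj_ofReal, ← vtx_one] at h3
    exact h2.trans (Relation.ReflTransGen.stdSymm.symm _ _ h3)
  have hpow : ∀ j : ℕ, Relation.ReflTransGen R A (vtx k j * A) := fun j => by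
    induction j with
    | zero => simpa using Relation.ReflTransGen.refl
    | succ j ih =>
      have := hmul j hroot
      rw [← mul_assoc, ← vtx_add] at this
      exact ih.trans (by exact_mod_cast this)
  have hpolygon : ∀ p ∈ Q, p / A ∈ polygon k := fun p hp => by
    refine div_mem_polygon_of_chamber hk hA ?_ ?_ (hside p hp)
    · rcases h0 p hp with h | h <;> linarith
    · rcases h1 p hp with h | h <;> linarith
  refine ⟨hA, ?_, ?_, ?_, ?_, ?_, ?_⟩
  · simpa using subset_orbit Q hAQ
  · intro c hc
    rw [Set.Finite.mem_toFinset] at hc ⊢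
    rw [← vtx_one]
    exact vtx_mul_mem_orbit hc 1
  · intro c hc
    rw [Set.Finite.mem_toFinset] at hc ⊢
    exact conj_mem_orbit hc
  · intro c hc
    rw [Set.Finite.mem_toFinset] at hc
    obtain ⟨p, hp, j, rfl | rfl⟩ := hc
    · rw [mul_div_assoc]
      exact mul_mem_polygon j (hpolygon p hp)
    · rw [mul_div_assoc, ← conj_ofReal A, ← map_div₀]
      exact mul_mem_polygon j (conj_mem_polygon (hpolygon p hp))
  · intro c hc c' hc' hne
    rw [Set.Finite.mem_toFinset] at hc hc'
    exact orbit_separated (by omega) h0 h1 h01 hsep hc hc' hne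
  · intro c hc
    rw [Set.Finite.mem_toFinset] at hc
    have hreach : Relation.ReflTransGen R A c := by
      obtain ⟨p, hp, j, rfl | rfl⟩ := hc <;> obtain ⟨m, -, hm⟩ := exists_nat_vtx_eq hk0 j <;>
        rw [← hm]
      · exact (hpow m).trans (hmul m (hRQ p hp))
      · have := hmul m (hconj (hRQ p hp))
        rw [conj_ofReal] at this
        exact (hpow m).trans this
    exact Relation.ReflTransGen.mono (fun x y hxy => ⟨by simpa using hxy.2.1, hxy.2.2⟩) _ _ hreach

/-- A fractal without the good labelling property, generated by steps along the direction
`vtx k a - vtx k b`. -/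
theorem exists_fractal_not_hasGLP (hk : k = 6 ∨ 9 ≤ k) (hd : 3 ≤ d) (hde : k = d * e) (hdk : d ≤ k)
    {t : ℕ} (ht : 1 ≤ t) (htk : 6 * t ≤ k) (ht2 : t ≤ 2) {a b s : ℤ} (hab : a + b = t)
    (hs : a - b = s) (hw : 2 * Real.sin (Real.pi * s / k) = width k) (hds : ¬ (k : ℤ) ∣ d * s) :
    ∃ (S : SimilitudeSystem) (K : Set ℂ), S.IsSimpleNestedFractal K ∧
      (0 : ℂ) ∈ S.essentialFixedPoints ∧ S.k = k ∧ ¬ S.HasGLP K := by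
  have hk0 : k ≠ 0 := by omega
  have hk6 : (6 : ℝ) ≤ k := by exact_mod_cast (by omega : 6 ≤ k)
  have hpi := Real.pi_pos
  have hwpos := width_pos (k := k) (by omega)
  have hsin := sin_pi_div_pos (k := k) (by omega)
  set θ := Real.pi / k with hθ
  have hθ6 : θ ≤ Real.pi / 6 := div_le_div_of_nonneg_left hpi.le (by norm_num) hk6
  have hθ0 : 0 < θ := by positivity
  -- The step `u` has direction `π / 2 + β`. Thus `β` measures its tilt against the normal of the
  -- real axis, and `β'` against the normal of the wall at angle `θ`.
  set β := t * θ with hβ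
  set β' := (t - 1) * θ with hβ'
  have ht' : (1 : ℝ) ≤ t := by exact_mod_cast ht
  have ht2' : (t : ℝ) ≤ 2 := by exact_mod_cast ht2
  have htk' : (6 * t : ℝ) ≤ k := by exact_mod_cast htk
  have hβ0 : 0 ≤ β := by positivity
  have hβ6 : β ≤ Real.pi / 6 := by
    rw [hβ, hθ, mul_div_assoc', div_le_div_iff₀ (by linarith) (by norm_num)]
    nlinarith
  have hβ'0 : 0 ≤ β' := mul_nonneg (by linarith) hθ0.le
  have hβ'θ : β' ≤ θ := by nlinarith
  set u := vtx k a - vtx k b with hu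
  have hu_eq : u = width k * I * exp (β * I) := by
    have e1 : vtx k a = vtx (2 * k) t * vtx (2 * k) s := by
      rw [← vtx_two_mul, ← vtx_add]; congr 1; omega
    have e2 : vtx k b = vtx (2 * k) t * vtx (2 * k) (-s) := by
      rw [← vtx_two_mul, ← vtx_add]; congr 1; omega
    have e3 : (vtx (2 * k) s).im = Real.sin (Real.pi * s / k) := by
      rw [vtx_two_mul_eq, exp_ofReal_mul_I_im]
    have e4 : vtx (2 * k) t = exp (β * I) := by
      rw [vtx_two_mul_eq, hβ, hθ]
      congr 3
      push_cast
      ring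
    rw [hu, e1, e2, ← mul_sub, ← conj_vtx, sub_conj, e3, hw, e4]
    ring
  have hu_step : IsStep k u := by
    refine ⟨?_, a, b, rfl⟩
    rw [hu_eq, norm_mul, norm_exp_ofReal_mul_I, norm_mul, norm_I, norm_real, Real.norm_eq_abs,
      abs_of_pos hwpos]
    ring
  -- Stem and ring stay within `d + 2` of the middle `n` of the segment, and tilts up to `π / 6`
  -- cost a factor of at least `4 / 5`; `4 / 5 * n - (d + 2)` still exceeds `1 / 2`.
  set n := 2 * d + 6 with hn
  set Z := model k d n with hZ
  have hZ0 : (0 : ℂ) ∈ Z := Or.inl ⟨0, by omega, by simp⟩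
  have hZm : ((2 * n : ℕ) : ℂ) ∈ Z := Or.inl ⟨2 * n, le_rfl, rfl⟩
  have hcosβ' := four_fifths_le_cos hβ'0 (hβ'θ.trans hθ6)
  -- This circumradius puts the end `f (2 * n)` of the row exactly on the second wall.
  set A := width k * ((2 * n : ℕ) * Real.cos β') / Real.sin θ with hA_def
  have hA : 0 < A := by positivity
  set f : ℂ → ℂ := fun z => A + u * z with hf
  have hf_im : ∀ z, (f z).im = width k * (exp (β * I) * z).re := fun z => by
    have : f z = A + width k * (I * (exp (β * I) * z)) := by
      simp only [hf, hu_eq]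
      ring
    rw [this, add_im, ofReal_im, im_ofReal_mul, I_mul_im, zero_add]
  have hrot : ∀ z, f z * exp (-(θ : ℂ) * I) =
      A * exp ((-θ : ℝ) * I) + width k * (I * (exp (β' * I) * z)) := fun z => by
    have : exp (β' * I) = exp (β * I) * exp (-(θ : ℂ) * I) := by
      rw [← exp_add, hβ', hβ]
      congr 1
      push_cast
      ring
    simp only [hf, hu_eq, this]
    push_cast
    ring
  have hrot_im : ∀ p : ℂ, (p * exp (-(θ : ℂ) * I)).im = -wall k p := fun p => by
    rw [← ofReal_neg, mul_im, exp_ofReal_mul_I_re, exp_ofReal_mul_I_im, wall, Real.cos_neg,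
      Real.sin_neg]
    ring
  have hrot_re : ∀ p : ℂ, (p * exp (-(θ : ℂ) * I)).re =
      p.re * Real.cos θ + p.im * Real.sin θ := fun p => by
    rw [← ofReal_neg, mul_re, exp_ofReal_mul_I_re, exp_ofReal_mul_I_im, Real.cos_neg,
      Real.sin_neg]
    ring
  have hf_wall : ∀ z, wall k (f z) = width k * (exp (β' * I) * ((2 * n : ℕ) - z)).re :=
    fun z => by
    have h1 := hrot_im (f z)
    have h3 : A * Real.sin θ = width k * ((2 * n : ℕ) * Real.cos β') :=
      div_mul_cancel₀ _ hsin.ne'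
    have h4 : (exp (β' * I) * ((2 * n : ℕ) : ℂ)).re = (2 * n : ℕ) * Real.cos β' := by
      rw [← ofReal_natCast, re_mul_ofReal, exp_ofReal_mul_I_re, mul_comm]
    rw [hrot, add_im, im_ofReal_mul, im_ofReal_mul, I_mul_im, exp_ofReal_mul_I_im,
      Real.sin_neg] at h1
    rw [mul_sub, sub_re, h4]
    linarith
  have hf_side : ∀ z ∈ Z, (f z).re * Real.cos θ + (f z).im * Real.sin θ ≤ A * Real.cos θ := by
    intro z hz
    have h1 := model_im_nonneg hk hd hdk hβ'0 hβ'θ hz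
    rw [← hrot_re, hrot, add_re, re_ofReal_mul, re_ofReal_mul, I_mul_re, exp_ofReal_mul_I_re,
      Real.cos_neg]
    nlinarith
  have hf_sub : ∀ z z', f z - f z' = u * (z - z') := fun z z' => by
    simp only [hf]
    ring
  have hstep : ∀ z, IsUnitStep k z → IsStep k (u * z) := by
    rintro _ ⟨j, rfl | rfl⟩
    · rw [mul_comm]
      exact hu_step.vtx_mul j
    · rw [mul_neg, mul_comm]
      exact (hu_step.vtx_mul j).neg
  have hC := isConfiguration_orbit (k := k) (by omega) hA (Q := f '' Z)
    ((model_finite (by omega)).image f) ⟨0, hZ0, by simp [hf]⟩ (B := f (2 * n : ℕ))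
    ⟨_, hZm, rfl⟩ (by rw [hf_wall]; simp)
    (by
      rintro _ ⟨z, hz, rfl⟩
      rw [hf_im]
      rcases model_left hβ0 hβ6 (by omega) hn.ge hz with rfl | h
      · left; simp
      · right; nlinarith)
    (by
      rintro _ ⟨z, hz, rfl⟩
      rw [hf_wall]
      rcases model_right hβ'0 (hβ'θ.trans hθ6) (by omega) hn.ge hz with rfl | h
      · left; simp
      · right; nlinarith)
    (by
      rintro _ ⟨z, hz, rfl⟩ _ ⟨z', hz', rfl⟩ h0 h1
      rw [hf_im] at h0
      rw [hf_wall] at h1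
      have hz0 : z = 0 := (model_left hβ0 hβ6 (by omega) hn.ge hz).resolve_right fun h => by
        nlinarith
      have hz1 : z' = (2 * n : ℕ) :=
        (model_right hβ'0 (hβ'θ.trans hθ6) (by omega) hn.ge hz').resolve_right fun h => by
          nlinarith
      rw [hf_sub, hz0, hz1, zero_sub, norm_mul, norm_neg, norm_natCast, hu_step.1]
      have : (1 : ℝ) < (2 * n : ℕ) := by exact_mod_cast (by omega : 1 < 2 * n)
      nlinarith)
    (by
      rintro _ ⟨z, hz, rfl⟩ _ ⟨z', hz', rfl⟩ hne
      rw [hf_sub]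
      refine (model_separated hk hd hde hz hz' fun h => hne (by rw [h])).imp (fun h => ?_)
        (hstep _)
      rw [norm_mul, hu_step.1]
      nlinarith)
    (by
      rintro _ ⟨z, hz, rfl⟩
      exact hf_side z hz)
    (by
      rintro _ ⟨z, hz, rfl⟩
      have h1 := (model_connected (n := n) hk0 (by omega) hde hz).lift
        (p := fun x y => y ∈ f '' Z ∧ IsStep k (y - x)) f fun x y hxy =>
          ⟨⟨y, hxy.1, rfl⟩, by rw [hf_sub]; exact hstep _ hxy.2⟩
      have h2 : f 0 = A := by simp [hf]
      rw [← h2]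
      exact h1)
  obtain ⟨K, hK⟩ := hC.exists_isSimpleNestedFractal (by omega)
  refine ⟨_, K, hK, ?_, hC.system_k (by omega), ?_⟩
  · rw [hC.essentialFixedPoints_eq (by omega)]
    exact ⟨0, by simp⟩
  -- The closed chain is the ring; turning its side by `2π / d` adds `e` to both vertex indices and
  -- leaves their difference `s` unchanged.
  · refine hC.not_hasGLP (by omega) hK.isFractal (d := d) (s := s)
      (c := fun l => f (n + (2 * vtx k (k / 4 : ℕ) + ringPoint d l)))
      (a := fun l => a + e * l) (b := fun l => b + e * l) ?_ ?_ ?_ ?_ hds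
    · intro l
      rw [Set.Finite.mem_toFinset]
      exact subset_orbit _ ⟨_, Or.inr (Or.inr ⟨l, rfl⟩), rfl⟩
    · simp only [Nat.cast_zero, ringPoint_zero, ringPoint_self (d := d) (by omega)]
    · intro l
      have h1 := ringPoint_succ_sub (d := d) (by omega) l
      have h2 : vtx k (a + e * l) - vtx k (b + e * l) = u * vtx d l := by
        rw [vtx_mul hk0 hde, vtx_add, vtx_add, ← sub_mul]
      rw [h2, ← h1, hf_sub]
      push_cast
      ring
    · intro l
      rw [← hs]
      ring

end PolygonFractal

/-! ### The arithmetic choice of `d`, `s` and `t`. -/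

theorem mainTheorem3 (k : ℕ) (hk : 1 < k) (hcomposite : ¬ k.Prime) (hpow : ∀ n : ℕ, k ≠ 2 ^ n) :
    ∃ (S : NestedFractal.SimilitudeSystem) (K : Set ℂ),
      S.IsSimpleNestedFractal K ∧ (0 : ℂ) ∈ S.essentialFixedPoints ∧ S.k = k ∧ ¬ S.HasGLP K := by
  obtain ⟨d, hd, ⟨e, hde⟩, hodd⟩ : ∃ d, Nat.Prime d ∧ d ∣ k ∧ Odd d := by
    rcases Nat.eq_two_pow_or_exists_odd_prime_and_dvd k with ⟨n, hn⟩ | h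
    · exact absurd hn (hpow n)
    · exact h
  have hd3 : 3 ≤ d := by
    have := hd.two_le
    obtain ⟨m, hm⟩ := hodd
    omega
  have he2 : 2 ≤ e := by
    rcases e with - | - | e
    · simp at hde
      omega
    · simp at hde
      exact absurd (hde ▸ hd) hcomposite
    · omega
  have hdk : 2 * d ≤ k := by nlinarith
  have hk7 : k ≠ 7 := by
    rintro rfl
    exact hcomposite (by norm_num)
  have hk8 := hpow 3
  have hk69 : k = 6 ∨ 9 ≤ k := by
    have h4 : k ≠ 8 := by simpa using hk8
    omega
  have h4k : k % 4 = 0 → 12 ≤ k := by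
    have h4 : k ≠ 8 := by simpa using hk8
    omega
  have hk0 : (k : ℝ) ≠ 0 := by
    have : k ≠ 0 := by omega
    exact_mod_cast this
  -- `a + b = t` and `a - b = s` require equal parity. If `4 ∣ k`, then `s = k / 2` is even and `t =
  -- 2`, which needs `12 ≤ k`. Otherwise an odd `s` realizing the diameter exists, namely `k / 2 +
  -- 1` when `k % 4 = 1`, and `t = 1`.
  obtain ⟨t, s, ht1, ht2, htk, hpar, hw, hs⟩ : ∃ t s : ℕ, 1 ≤ t ∧ t ≤ 2 ∧ 6 * t ≤ k ∧
      (t + s) % 2 = 0 ∧ 2 * Real.sin (Real.pi * s / k) = PolygonFractal.width k ∧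
      (k = 2 * s ∨ k = 2 * s + 1 ∨ k + 1 = 2 * s) := by
    rcases (by omega : k % 4 = 0 ∨ k % 4 = 2 ∨ k % 4 = 3 ∨ k % 4 = 1) with h | h | h | h
    · exact ⟨2, k / 2, by omega, le_rfl, by omega, by omega, rfl, by omega⟩
    · exact ⟨1, k / 2, le_rfl, by omega, by omega, by omega, rfl, by omega⟩
    · exact ⟨1, k / 2, le_rfl, by omega, by omega, by omega, rfl, by omega⟩
    · refine ⟨1, k / 2 + 1, le_rfl, by omega, by omega, by omega, ?_, by omega⟩
      have hq : (k : ℝ) = 2 * (k / 2 : ℕ) + 1 := by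
        exact_mod_cast (by omega : k = 2 * (k / 2) + 1)
      rw [PolygonFractal.width, ← Real.sin_pi_sub (Real.pi * (k / 2 : ℕ) / k)]
      congr 2
      rw [div_eq_iff hk0, sub_mul, div_mul_cancel₀ _ hk0]
      nth_rewrite 1 [hq]
      push_cast
      ring
  refine PolygonFractal.exists_fractal_not_hasGLP hk69 hd3 hde (by omega) ht1 htk ht2
    (a := ((t + s) / 2 : ℕ)) (b := t - ((t + s) / 2 : ℕ)) (s := s) (by ring) (by omega)
    (by exact_mod_cast hw) ?_
  intro hdvd
  have hdvd' : k ∣ d * s := by exact_mod_cast hdvd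
  -- For `k = 2 * s`, cancelling `s` makes the odd `d` even; for `k = 2 * s ± 1`, doubling `d * s`
  -- leaves `k ∣ d`, against `2 * d ≤ k`.
  rcases hs with h | h | h
  · rw [h] at hdvd'
    have h2 : 2 ∣ d := Nat.dvd_of_mul_dvd_mul_right (by omega) hdvd'
    obtain ⟨m, hm⟩ := hodd
    omega
  · have h2 : (k : ℤ) ∣ d := by
      have h3 := dvd_sub (dvd_mul_right (k : ℤ) d) (hdvd.mul_left 2)
      rwa [show (k * d - 2 * (d * s) : ℤ) = d by rw [h]; push_cast; ring] at h3
    have := Nat.le_of_dvd (by omega) (Int.natCast_dvd_natCast.1 h2)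
    omega
  · have h2 : (k : ℤ) ∣ d := by
      have h3 := dvd_sub (hdvd.mul_left 2) (dvd_mul_right (k : ℤ) d)
      have h4 : (k : ℤ) + 1 = 2 * s := by exact_mod_cast h
      rwa [show (2 * (d * s) - k * d : ℤ) = d by linear_combination -(d : ℤ) * h4] at h3
    have := Nat.le_of_dvd (by omega) (Int.natCast_dvd_natCast.1 h2)
    omega
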